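/- Let $\mathbb K\in\{\mathbb R,\mathbb C\}$. For integers $m,n\ge 0$ let $\mathscr O^m_n(\mathbb R)$ be the Banach space of all $C^m$ functions $f:\mathbb R\to\mathbb K$ with $$|f|_{m,n}:=\sup_{x\in\mathbb R,\,0\le j\le m}(1+|x|^2)^{-n}|f^{(j)}(x)|<\infty ,$$ let $\mathscr O^m(\mathbb R)=\bigcup_n\mathscr O^m_n(\mathbb R)$ carry the locally convex inductive limit topology, and let $\mathscr O_M(\mathbb R)=\bigcap_m\mathscr O^m(\mathbb R)$ carry the projective limit topology of the spaces $\mathscr O^m(\mathbb R)$. For a real-valued $\psi\in\mathscr O_M(\mathbb R)$ let $C_\psi:\mathscr O_M(\mathbb R)\to\mathscr O_M(\mathbb R)$, $f\mapsto f\circ\psi$, which is a continuous linear operator; $C_{x+1}$ is the operator with symbol $x\mapsto x+1$. For a bijection $\psi:\mathbb R\to\mathbb R$ let $\psi_n$ denote the $n$-fold iterate of $\psi$ and $\psi_{-n}=(\psi_n)^{-1}$, $n\in\mathbb N$. Let $\mathscr S(\mathbb R)$ be the Schwartz space. Let $\psi\in\mathscr O_M(\mathbb R)$ be real-valued and bijective.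 Suppose that $C_\psi$ is mixing, that is, for all nonempty open sets $U,V\subseteq\mathscr O_M(\mathbb R)$ there is $N$ such that $C_\psi^n(U)\cap V\neq\emptyset$ for all $n\ge N$, and that for every $v\in\mathscr S(\mathbb R)$ $$\lim_{n\to\infty}v(\psi_n(0))\cdot n=0\quad\text{and}\quad\lim_{n\to\infty}v(\psi_{-n}(0))\cdot n=0 .$$ Then $C_\psi$ is quasi-conjugate to $C_{x+1}$, that is, there is a continuous linear map $\Phi:\mathscr O_M(\mathbb R)\to\mathscr O_M(\mathbb R)$ with dense range such that $C_\psi\circ\Phi=\Phi\circ C_{x+1}$. Moreover, $C_\psi$ is hypercyclic, that is, there is $f\in\mathscr O_M(\mathbb R)$ whose orbit $\{C_\psi^n f: n\ge 0\}$ is dense in $\mathscr O_M(\mathbb R)$, and $C_\psi$ is chaotic, that is, it is hypercyclic and its periodic points are dense in $\mathscr O_M(\mathbb R)$. -/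

import Mathlib

open Filter Topology
open scoped ContDiff SchwartzMap

noncomputable section

namespace SlowGrowth

section Spaces

/-- The weighted derivative `(1 + |x|²)⁻ⁿ |f⁽ʲ⁾(x)|`, for `x ∈ ℝ` and `0 ≤ j ≤ m`. -/
def weighted {𝕜 : Type*} [RCLike 𝕜] (m n : ℕ) (f : ℝ → 𝕜) (q : ℝ × Fin (m + 1)) : ℝ :=
  ((1 + |q.1| ^ 2) ^ n)⁻¹ * ‖iteratedDeriv (q.2 : ℕ) f q.1‖

/-- The norm `|f|_{m,n} = sup_{x ∈ ℝ, 0 ≤ j ≤ m} (1 + |x|²)⁻ⁿ |f⁽ʲ⁾(x)|`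
(a genuine supremum for the elements of `Omn 𝕜 m n`). -/
def omnNorm {𝕜 : Type*} [RCLike 𝕜] (m n : ℕ) (f : ℝ → 𝕜) : ℝ :=
  ⨆ q : ℝ × Fin (m + 1), weighted m n f q

theorem bddAbove_weighted_iff {𝕜 : Type*} [RCLike 𝕜] {m n : ℕ} {f : ℝ → 𝕜} :
    BddAbove (Set.range (weighted m n f)) ↔
      ∃ C : ℝ, ∀ j ≤ m, ∀ x : ℝ, ‖iteratedDeriv j f x‖ ≤ C * (1 + |x| ^ 2) ^ n := by
  constructor
  · rintro ⟨C, hC⟩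
    refine ⟨C, fun j hj x => ?_⟩
    have h := hC ⟨(x, ⟨j, Nat.lt_succ_of_le hj⟩), rfl⟩
    have hp : (0 : ℝ) < (1 + |x| ^ 2) ^ n := by positivity
    simp only [weighted] at h
    rwa [inv_mul_le_iff₀ hp, mul_comm] at h
  · rintro ⟨C, hC⟩
    refine ⟨C, ?_⟩
    rintro _ ⟨⟨x, j⟩, rfl⟩
    have hp : (0 : ℝ) < (1 + |x| ^ 2) ^ n := by positivity
    simp only [weighted]
    rw [inv_mul_le_iff₀ hp, mul_comm]
    exact hC j (Nat.le_of_lt_succ j.2) x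

theorem le_omnNorm {𝕜 : Type*} [RCLike 𝕜] {m n : ℕ} {f : ℝ → 𝕜}
    (hf : BddAbove (Set.range (weighted m n f))) {j : ℕ} (hj : j ≤ m) (x : ℝ) :
    ‖iteratedDeriv j f x‖ ≤ omnNorm m n f * (1 + |x| ^ 2) ^ n := by
  have h : weighted m n f (x, ⟨j, Nat.lt_succ_of_le hj⟩) ≤ omnNorm m n f := le_ciSup hf _
  have hp : (0 : ℝ) < (1 + |x| ^ 2) ^ n := by positivity
  simp only [weighted] at h
  rwa [inv_mul_le_iff₀ hp, mul_comm] at h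

theorem omnNorm_le {𝕜 : Type*} [RCLike 𝕜] {m n : ℕ} {f : ℝ → 𝕜} {C : ℝ}
    (h : ∀ j ≤ m, ∀ x : ℝ, ‖iteratedDeriv j f x‖ ≤ C * (1 + |x| ^ 2) ^ n) :
    omnNorm m n f ≤ C := by
  refine ciSup_le ?_
  rintro ⟨x, j⟩
  have hp : (0 : ℝ) < (1 + |x| ^ 2) ^ n := by positivity
  simp only [weighted]
  rw [inv_mul_le_iff₀ hp, mul_comm]
  exact h j (Nat.le_of_lt_succ j.2) x

/-- The space `𝒪_n^m(ℝ)` of the `Cᵐ` functions `f : ℝ → 𝕜` with `|f|_{m,n} < ∞`. -/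
def Omn (𝕜 : Type*) [RCLike 𝕜] (m n : ℕ) : Submodule 𝕜 (ℝ → 𝕜) where
  carrier := {f | ContDiff ℝ m f ∧ BddAbove (Set.range (weighted m n f))}
  zero_mem' := by
    refine ⟨contDiff_const, bddAbove_weighted_iff.2 ⟨0, fun j _ x => ?_⟩⟩
    have : (0 : ℝ → 𝕜) = fun _ => 0 := rfl
    simp [this]
  add_mem' := by
    rintro f g ⟨hf, hf'⟩ ⟨hg, hg'⟩
    obtain ⟨C, hC⟩ := bddAbove_weighted_iff.1 hf'
    obtain ⟨D, hD⟩ := bddAbove_weighted_iff.1 hg'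
    refine ⟨hf.add hg, bddAbove_weighted_iff.2 ⟨C + D, fun j hj x => ?_⟩⟩
    rw [iteratedDeriv_add (hf.contDiffAt.of_le (by exact_mod_cast hj))
      (hg.contDiffAt.of_le (by exact_mod_cast hj)), add_mul]
    exact (norm_add_le _ _).trans (add_le_add (hC j hj x) (hD j hj x))
  smul_mem' := by
    rintro c f ⟨hf, hf'⟩
    obtain ⟨C, hC⟩ := bddAbove_weighted_iff.1 hf'
    refine ⟨contDiff_const.smul hf, bddAbove_weighted_iff.2 ⟨‖c‖ * C, fun j hj x => ?_⟩⟩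
    rw [iteratedDeriv_const_smul_field, norm_smul, mul_assoc]
    exact mul_le_mul_of_nonneg_left (hC j hj x) (norm_nonneg c)

theorem Omn_mono (𝕜 : Type*) [RCLike 𝕜] (m : ℕ) : Monotone (Omn 𝕜 m) := by
  rintro n n' hn f ⟨hf, hf'⟩
  obtain ⟨C, hC⟩ := bddAbove_weighted_iff.1 hf'
  refine ⟨hf, bddAbove_weighted_iff.2 ⟨|C|, fun j hj x => ?_⟩⟩
  calc ‖iteratedDeriv j f x‖ ≤ C * (1 + |x| ^ 2) ^ n := hC j hj x
    _ ≤ |C| * (1 + |x| ^ 2) ^ n := by gcongr; exact le_abs_self C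
    _ ≤ |C| * (1 + |x| ^ 2) ^ n' := by
        gcongr
        exact le_add_of_nonneg_right (by positivity)

/-- The space `𝒪^m(ℝ) = ⋃_n 𝒪_n^m(ℝ)`. -/
def Om (𝕜 : Type*) [RCLike 𝕜] (m : ℕ) : Submodule 𝕜 (ℝ → 𝕜) where
  carrier := ⋃ n, (Omn 𝕜 m n : Set (ℝ → 𝕜))
  zero_mem' := Set.mem_iUnion.2 ⟨0, (Omn 𝕜 m 0).zero_mem⟩
  add_mem' := by
    intro f g hf hg
    obtain ⟨n, hn⟩ := Set.mem_iUnion.1 hf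
    obtain ⟨k, hk⟩ := Set.mem_iUnion.1 hg
    exact Set.mem_iUnion.2 ⟨max n k, (Omn 𝕜 m _).add_mem
      (Omn_mono 𝕜 m (le_max_left n k) hn) (Omn_mono 𝕜 m (le_max_right n k) hk)⟩
  smul_mem' := by
    intro c f hf
    obtain ⟨n, hn⟩ := Set.mem_iUnion.1 hf
    exact Set.mem_iUnion.2 ⟨n, (Omn 𝕜 m n).smul_mem c hn⟩

theorem mem_Om {𝕜 : Type*} [RCLike 𝕜] {m : ℕ} {f : ℝ → 𝕜} :
    f ∈ Om 𝕜 m ↔ ∃ n, f ∈ Omn 𝕜 m n :=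
  Set.mem_iUnion

/-- The seminorms on `𝒪^m(ℝ)` whose restriction to each Banach space
`(𝒪_n^m(ℝ), |·|_{m,n})` is continuous. -/
abbrev IndSeminorm (𝕜 : Type*) [RCLike 𝕜] (m : ℕ) : Type _ :=
  {p : Seminorm 𝕜 (Om 𝕜 m) //
    ∀ n, ∃ C : ℝ, ∀ f : Om 𝕜 m, (f : ℝ → 𝕜) ∈ Omn 𝕜 m n → p f ≤ C * omnNorm m n (f : ℝ → 𝕜)}

instance (𝕜 : Type*) [RCLike 𝕜] (m : ℕ) : Nonempty (IndSeminorm 𝕜 m) :=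
  ⟨⟨0, fun _ => ⟨0, fun _ _ => by simp⟩⟩⟩

/-- The family of all the seminorms in `IndSeminorm 𝕜 m`. -/
def indFamily (𝕜 : Type*) [RCLike 𝕜] (m : ℕ) : SeminormFamily 𝕜 (Om 𝕜 m) (IndSeminorm 𝕜 m) :=
  fun p => p.1

/-- The topology of the (LB)-space `𝒪^m(ℝ) = ind_n 𝒪_n^m(ℝ)`: the locally convex inductive limit
topology, that is, the one generated by all seminorms that are continuous on every step. -/
abbrev omTopology (𝕜 : Type*) [RCLike 𝕜] (m : ℕ) : TopologicalSpace (Om 𝕜 m) :=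
  (indFamily 𝕜 m).moduleFilterBasis.topology

/-- The set `𝒪_M(ℝ) = ⋂_m ⋃_n 𝒪_n^m(ℝ)` of slowly increasing smooth functions `ℝ → 𝕜`. -/
def OM (𝕜 : Type*) [RCLike 𝕜] : Submodule 𝕜 (ℝ → 𝕜) :=
  ⨅ m, Om 𝕜 m

theorem mem_OM {𝕜 : Type*} [RCLike 𝕜] {f : ℝ → 𝕜} :
    f ∈ OM 𝕜 ↔ ∀ m, ∃ n, f ∈ Omn 𝕜 m n := by
  simp [OM, Submodule.mem_iInf, mem_Om]

/-- The locally convex space `𝒪_M(ℝ)`; a type of its own, since its topology is not the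
topology of pointwise convergence that `OM 𝕜` inherits from `ℝ → 𝕜`. -/
def OMSpace (𝕜 : Type*) [RCLike 𝕜] : Type _ := ↥(OM 𝕜)

instance (𝕜 : Type*) [RCLike 𝕜] : AddCommGroup (OMSpace 𝕜) :=
  inferInstanceAs (AddCommGroup ↥(OM 𝕜))

instance (𝕜 : Type*) [RCLike 𝕜] : Module 𝕜 (OMSpace 𝕜) :=
  inferInstanceAs (Module 𝕜 ↥(OM 𝕜))

/-- The function underlying an element of `𝒪_M(ℝ)`. -/
def OMSpace.toFun {𝕜 : Type*} [RCLike 𝕜] (f : OMSpace 𝕜) : ℝ → 𝕜 := f.1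

/-- The inclusion `𝒪_M(ℝ) → 𝒪^m(ℝ)`. -/
def toOm (𝕜 : Type*) [RCLike 𝕜] (m : ℕ) : OMSpace 𝕜 →ₗ[𝕜] Om 𝕜 m :=
  Submodule.inclusion (iInf_le (Om 𝕜) m)

/-- `𝒪_M(ℝ)` carries the projective limit topology of the (LB)-spaces `𝒪^m(ℝ)`. -/
instance (𝕜 : Type*) [RCLike 𝕜] : TopologicalSpace (OMSpace 𝕜) :=
  ⨅ m, (omTopology 𝕜 m).induced (toOm 𝕜 m)

end Spaces

section Composition

theorem comp_bound {ψ : ℝ → ℝ} (hψ : ψ ∈ OM ℝ) (𝕜 : Type*) [RCLike 𝕜] (m n : ℕ) :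
    ∃ (n' : ℕ) (K : ℝ), ∀ f ∈ Omn 𝕜 m n,
      f ∘ ψ ∈ Omn 𝕜 m n' ∧ omnNorm m n' (f ∘ ψ) ≤ K * omnNorm m n f := by
  obtain ⟨k, hk, hk'⟩ := mem_OM.1 hψ m
  obtain ⟨C, hC⟩ := bddAbove_weighted_iff.1 hk'
  have key : ∀ f ∈ Omn 𝕜 m n, ∀ j ≤ m, ∀ x : ℝ, ‖iteratedDeriv j (f ∘ ψ) x‖ ≤
      (m.factorial * (2 * (1 + |C|) ^ 2) ^ n * (1 + |C|) ^ m) * omnNorm m n f *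
        (1 + |x| ^ 2) ^ (2 * k * n + k * m) := by
    rintro f ⟨hf, hf'⟩ j hj x
    have hN : 0 ≤ omnNorm m n f :=
      Real.iSup_nonneg fun q => by unfold weighted; positivity
    have hw : (1 : ℝ) ≤ 1 + |x| ^ 2 := le_add_of_nonneg_right (by positivity)
    have hwk : (1 : ℝ) ≤ (1 + |x| ^ 2) ^ k := one_le_pow₀ hw
    have hA : (1 : ℝ) ≤ 1 + |C| := le_add_of_nonneg_right (abs_nonneg C)
    set D : ℝ := (1 + |C|) * (1 + |x| ^ 2) ^ k with hD
    have hD1 : 1 ≤ D := one_le_mul_of_one_le_of_one_le hA hwk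
    have hψD : ∀ i ≤ m, ‖iteratedDeriv i ψ x‖ ≤ D := fun i hi => by
      refine (hC i hi x).trans ?_
      rw [hD]
      gcongr
      exact (le_abs_self C).trans (by simp)
    have h0 : |ψ x| ≤ D := by simpa using hψD 0 (Nat.zero_le _)
    have h1 : 1 + |ψ x| ^ 2 ≤ 2 * D ^ 2 := by
      have : |ψ x| ^ 2 ≤ D ^ 2 := by gcongr
      nlinarith
    have hcomp := norm_iteratedFDeriv_comp_le (𝕜 := ℝ) (g := f) (f := ψ) (n := j) (N := m)
      hf hk (by exact_mod_cast hj) x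
      (C := omnNorm m n f * (2 * D ^ 2) ^ n) (D := D)
      (fun i hi => by
        rw [norm_iteratedFDeriv_eq_norm_iteratedDeriv]
        refine (le_omnNorm hf' (hi.trans hj) (ψ x)).trans ?_
        gcongr)
      (fun i hi1 hi => by
        rw [norm_iteratedFDeriv_eq_norm_iteratedDeriv]
        exact (hψD i (hi.trans hj)).trans (le_self_pow₀ hD1 (by omega)))
    rw [norm_iteratedFDeriv_eq_norm_iteratedDeriv] at hcomp
    have hfac : (j.factorial : ℝ) ≤ m.factorial := by exact_mod_cast Nat.factorial_le hj
    calc ‖iteratedDeriv j (f ∘ ψ) x‖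
        ≤ j.factorial * (omnNorm m n f * (2 * D ^ 2) ^ n) * D ^ j := hcomp
      _ ≤ m.factorial * (omnNorm m n f * (2 * D ^ 2) ^ n) * D ^ m := by
          gcongr
      _ = _ := by
          rw [hD]
          simp only [mul_pow, ← pow_mul]
          ring
  refine ⟨2 * k * n + k * m, m.factorial * (2 * (1 + |C|) ^ 2) ^ n * (1 + |C|) ^ m,
    fun f hf => ⟨⟨hf.1.comp hk, bddAbove_weighted_iff.2 ⟨_, key f hf⟩⟩, omnNorm_le (key f hf)⟩⟩

theorem comp_mem_Om {ψ : ℝ → ℝ} (hψ : ψ ∈ OM ℝ) {𝕜 : Type*} [RCLike 𝕜] {m : ℕ} {f : ℝ → 𝕜}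
    (hf : f ∈ Om 𝕜 m) : f ∘ ψ ∈ Om 𝕜 m := by
  obtain ⟨n, hn⟩ := mem_Om.1 hf
  obtain ⟨n', K, h⟩ := comp_bound hψ 𝕜 m n
  exact mem_Om.2 ⟨n', (h f hn).1⟩

theorem comp_mem_OM {ψ : ℝ → ℝ} (hψ : ψ ∈ OM ℝ) {𝕜 : Type*} [RCLike 𝕜] {f : ℝ → 𝕜}
    (hf : f ∈ OM 𝕜) : f ∘ ψ ∈ OM 𝕜 := by
  rw [OM, Submodule.mem_iInf] at hf ⊢
  exact fun m => comp_mem_Om hψ (hf m)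

/-- Composition with `ψ` on `𝒪^m(ℝ)`. -/
def compOm (𝕜 : Type*) [RCLike 𝕜] {ψ : ℝ → ℝ} (hψ : ψ ∈ OM ℝ) (m : ℕ) :
    Om 𝕜 m →ₗ[𝕜] Om 𝕜 m where
  toFun f := ⟨(f : ℝ → 𝕜) ∘ ψ, comp_mem_Om hψ f.2⟩
  map_add' _ _ := rfl
  map_smul' _ _ := rfl

theorem continuous_compOm (𝕜 : Type*) [RCLike 𝕜] {ψ : ℝ → ℝ} (hψ : ψ ∈ OM ℝ) (m : ℕ) :
    Continuous[omTopology 𝕜 m, omTopology 𝕜 m] (compOm 𝕜 hψ m) := by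
  have hW := @WithSeminorms.mk 𝕜 (Om 𝕜 m) (IndSeminorm 𝕜 m) _ _ _ (indFamily 𝕜 m)
    (omTopology 𝕜 m) rfl
  refine WithSeminorms.continuous_of_isBounded hW hW (compOm 𝕜 hψ m) ?_
  intro p
  suffices h : ∀ n, ∃ C : ℝ, ∀ f : Om 𝕜 m, (f : ℝ → 𝕜) ∈ Omn 𝕜 m n →
      p.1.comp (compOm 𝕜 hψ m) f ≤ C * omnNorm m n (f : ℝ → 𝕜) by
    refine ⟨{(⟨p.1.comp (compOm 𝕜 hψ m), h⟩ : IndSeminorm 𝕜 m)}, 1, ?_⟩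
    rw [Finset.sup_singleton, one_smul]
    exact le_rfl
  intro n
  obtain ⟨n', K, h⟩ := comp_bound hψ 𝕜 m n
  obtain ⟨C, hC⟩ := p.2 n'
  refine ⟨|C| * K, fun f hf => ?_⟩
  have hnn : 0 ≤ omnNorm m n' ((f : ℝ → 𝕜) ∘ ψ) :=
    Real.iSup_nonneg fun q => by unfold weighted; positivity
  calc p.1 (compOm 𝕜 hψ m f) ≤ C * omnNorm m n' ((f : ℝ → 𝕜) ∘ ψ) := hC _ (h f hf).1
    _ ≤ |C| * omnNorm m n' ((f : ℝ → 𝕜) ∘ ψ) := by gcongr; exact le_abs_self C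
    _ ≤ |C| * (K * omnNorm m n (f : ℝ → 𝕜)) := by gcongr; exact (h f hf).2
    _ = _ := by ring

/-- The composition operator `C_ψ : 𝒪_M(ℝ) → 𝒪_M(ℝ)`, `f ↦ f ∘ ψ`, for `ψ ∈ 𝒪_M(ℝ)`. -/
def compOp (𝕜 : Type*) [RCLike 𝕜] (ψ : ℝ → ℝ) (hψ : ψ ∈ OM ℝ) : OMSpace 𝕜 →L[𝕜] OMSpace 𝕜 where
  toFun f := ⟨f.toFun ∘ ψ, comp_mem_OM hψ f.2⟩
  map_add' _ _ := rfl
  map_smul' _ _ := rfl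
  cont := by
    refine continuous_iInf_rng.2 fun m => ?_
    refine continuous_iInf_dom (i := m) ?_
    refine continuous_induced_rng.2 ?_
    exact @Continuous.comp (OMSpace 𝕜) (Om 𝕜 m) (Om 𝕜 m)
      ((omTopology 𝕜 m).induced (toOm 𝕜 m)) (omTopology 𝕜 m) (omTopology 𝕜 m)
      (toOm 𝕜 m) (compOm 𝕜 hψ m) (continuous_compOm 𝕜 hψ m) continuous_induced_dom

/-- The symbol `x ↦ x + 1` of the translation operator belongs to `𝒪_M(ℝ)`. -/
theorem add_one_mem_OM : (fun x : ℝ => x + 1) ∈ OM ℝ := by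
  refine mem_OM.2 fun m => ⟨1, contDiff_id.add contDiff_const,
    bddAbove_weighted_iff.2 ⟨2, fun j _ x => ?_⟩⟩
  have h : (0 : ℝ) ≤ |x| ^ 2 := by positivity
  rcases j with _ | _ | j
  · simp only [iteratedDeriv_zero, Real.norm_eq_abs, pow_one]
    have := abs_add_le x 1
    rw [abs_one] at this
    nlinarith [sq_nonneg (|x| - 1)]
  · simp only [zero_add, iteratedDeriv_one, deriv_add_const, deriv_id'', norm_one, pow_one]
    nlinarith
  · have : iteratedDeriv (j + 1 + 1) (fun x : ℝ => x + 1) = 0 := by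
      rw [iteratedDeriv_succ', iteratedDeriv_succ']
      have h1 : deriv (deriv fun x : ℝ => x + 1) = fun _ => 0 := by
        funext y
        simp
      rw [h1]
      funext y
      simp
    rw [this]
    simp only [Pi.zero_apply, norm_zero, pow_one]
    nlinarith

end Composition

section Dynamics

/-- The iterates `ψ_k`, `k ∈ ℤ`, of a bijection `ψ : ℝ → ℝ`; for `k < 0`, `ψ_k` is the inverse
of `ψ_{-k}`. -/
def iter (ψ : ℝ → ℝ) (hψ : Function.Bijective ψ) (k : ℤ) : ℝ → ℝ :=
  ⇑((Equiv.ofBijective ψ hψ : Equiv.Perm ℝ) ^ k)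

/-- `T` is mixing: for all nonempty open `U`, `V`, the sets `Tⁿ(U)` and `V` meet for all large
`n`. -/
def IsMixing {X : Type*} [TopologicalSpace X] (T : X → X) : Prop :=
  ∀ U V : Set X, IsOpen U → IsOpen V → U.Nonempty → V.Nonempty →
    ∃ N : ℕ, ∀ n ≥ N, ((T^[n] '' U) ∩ V).Nonempty

/-- `T` is hypercyclic: some orbit `{x, T x, T² x, …}` is dense. -/
def IsHypercyclic {X : Type*} [TopologicalSpace X] (T : X → X) : Prop :=
  ∃ x : X, Dense (Set.range fun n : ℕ => T^[n] x)

/-- `T` is chaotic: it is hypercyclic and its periodic points are dense. -/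
def IsChaotic {X : Type*} [TopologicalSpace X] (T : X → X) : Prop :=
  IsHypercyclic T ∧ Dense (Function.periodicPts T)

/-- The operator `T` is quasi-conjugate to the operator `S`: `T ∘ Φ = Φ ∘ S` for some continuous
linear map `Φ` with dense range. -/
def IsQuasiConjugate {𝕜 X Y : Type*} [Semiring 𝕜]
    [AddCommMonoid X] [Module 𝕜 X] [TopologicalSpace X]
    [AddCommMonoid Y] [Module 𝕜 Y] [TopologicalSpace Y]
    (T : X →L[𝕜] X) (S : Y →L[𝕜] Y) : Prop :=
  ∃ Φ : Y →L[𝕜] X, DenseRange Φ ∧ T.comp Φ = Φ.comp S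

end Dynamics

end SlowGrowth

end

/-! The conjugating map is itself a composition operator. If `H` is a diffeomorphism of the line
with `H ∘ ψ = H + 1` (an Abel function) and `H ∈ 𝒪_M`, then `Φ = C_H` satisfies `C_ψ Φ = Φ C_{x+1}`.
Its range contains every compactly supported smooth `f`, since `f = (f ∘ H⁻¹) ∘ H`, and such
functions are dense (`isQuasiConjugate_of_abel`). A dense orbit and dense periodic points then pass
from the translation to `C_ψ`.

Existence of `H`. Mixing forbids fixed points and critical points of `ψ`, because at such a point
the values, respectively the derivatives, of `C_ψⁿ f` are too rigid. Hence `ψ` is a fixed-point-free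
diffeomorphism, and integrating a positive smooth invariant density gives `H` (`exists_abel`).

Growth of `H` (`abel_mem_OM`) is the heart of the matter. With the compact fundamental domain `K =
H⁻¹[0,1]` and `n = -⌊H x⌋`, the point `ψ_n x` lies in `K` and `H = H ∘ ψ_n - n`. So it is enough to
bound the derivatives of `ψ_n` at the points sent to `K` polynomially, uniformly in large `|n|`.
Were there no such bound, there would be a sequence `x_k` of bad points. Functions whose derivatives
up to a fixed order at `x_k` are at most `(1 + |x_k|²)^k` for all `k` contain a neighbourhood of
`0`; functions close to the identity on `K` contain a nonempty open set. Mixing, with the two sets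
in either order, produces `f = g ∘ ψ_n` with `f` of the first kind and `g` of the second. As `g'`
stays away from `0` on `K`, this can be solved for the derivatives of `ψ_n`
(`exists_deriv_bound_of_comp`), which contradicts the choice of `x_k`
(`exists_slow_growth_of_transport`).

The translation is treated directly: periodizing compactly supported functions gives dense periodic
points, and placing a dense sequence of them, each repeated infinitely often, at widely separated
positions gives a hypercyclic vector. -/

namespace SlowGrowth

/-! ### Convergence, open sets and membership criteria in `𝒪_M(ℝ)`. -/

section Topology

variable {𝕜 : Type*} [RCLike 𝕜]

theorem omnNorm_nonneg (m n : ℕ) (f : ℝ → 𝕜) : 0 ≤ omnNorm m n f :=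
  Real.iSup_nonneg fun q => by unfold weighted; positivity

theorem one_le_weight (x : ℝ) : (1 : ℝ) ≤ 1 + |x| ^ 2 :=
  le_add_of_nonneg_right (by positivity)

theorem withSeminorms_indFamily (𝕜 : Type*) [RCLike 𝕜] (m : ℕ) :
    @WithSeminorms 𝕜 (Om 𝕜 m) (IndSeminorm 𝕜 m) _ _ _ (indFamily 𝕜 m) (omTopology 𝕜 m) :=
  @WithSeminorms.mk 𝕜 (Om 𝕜 m) (IndSeminorm 𝕜 m) _ _ _ (indFamily 𝕜 m) (omTopology 𝕜 m) rfl

/-- The step norm balls control the convergence in `𝒪_M(ℝ)`. -/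
theorem tendsto_of_norm_le {ι : Type*} {l : Filter ι} {F : ι → OMSpace 𝕜} {f : OMSpace 𝕜}
    (h : ∀ m, ∃ n : ℕ, ∀ ε > 0, ∀ᶠ i in l, ∀ j ≤ m, ∀ x,
      ‖iteratedDeriv j (F i - f).toFun x‖ ≤ ε * (1 + |x| ^ 2) ^ n) :
    Tendsto F l (𝓝 f) := by
  rw [nhds_iInf, tendsto_iInf]
  intro m
  rw [@nhds_induced _ _ (omTopology 𝕜 m), tendsto_comap_iff]
  let _ := omTopology 𝕜 m
  refine ((withSeminorms_indFamily 𝕜 m).tendsto_nhds (toOm 𝕜 m ∘ F) (toOm 𝕜 m f)).2 ?_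
  intro p ε hε
  obtain ⟨n, hb⟩ := h m
  obtain ⟨C, hC⟩ := p.2 n
  filter_upwards [hb (ε / (|C| + 1)) (by positivity)] with i hi
  have hmem : (F i - f).toFun ∈ Omn 𝕜 m n := by
    refine ⟨?_, bddAbove_weighted_iff.2 ⟨_, hi⟩⟩
    obtain ⟨k, hk⟩ := mem_OM.1 (F i - f).2 m
    exact hk.1
  have h1 := hC (toOm 𝕜 m (F i - f)) hmem
  calc p.1 (toOm 𝕜 m (F i) - toOm 𝕜 m f) = p.1 (toOm 𝕜 m (F i - f)) := by
        rw [map_sub (toOm 𝕜 m)]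
    _ ≤ C * omnNorm m n (F i - f).toFun := h1
    _ ≤ |C| * omnNorm m n (F i - f).toFun :=
        mul_le_mul_of_nonneg_right (le_abs_self C) (omnNorm_nonneg _ _ _)
    _ ≤ |C| * (ε / (|C| + 1)) := mul_le_mul_of_nonneg_left (omnNorm_le hi) (abs_nonneg C)
    _ < (|C| + 1) * (ε / (|C| + 1)) := by gcongr; linarith
    _ = ε := by field_simp

theorem isOpen_seminorm_ball {m : ℕ} (p : IndSeminorm 𝕜 m) (f₀ : OMSpace 𝕜) (r : ℝ) :
    IsOpen {f : OMSpace 𝕜 | p.1 (toOm 𝕜 m (f - f₀)) < r} := by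
  let _ := omTopology 𝕜 m
  have hW := withSeminorms_indFamily 𝕜 m
  have := hW.topologicalAddGroup
  have h1 : Continuous (fun g : Om 𝕜 m => p.1 (g - toOm 𝕜 m f₀)) :=
    (hW.continuous_seminorm p).comp (continuous_id.sub continuous_const)
  have h2 : Continuous (toOm 𝕜 m) := continuous_iInf_dom (i := m) continuous_induced_dom
  have h3 := isOpen_lt (h1.comp h2) (continuous_const (y := r))
  simpa [Function.comp_def, map_sub] using h3

theorem contDiff_of_mem_OM {f : ℝ → 𝕜} (hf : f ∈ OM 𝕜) : ContDiff ℝ ∞ f :=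
  contDiff_infty.2 fun m => by
    obtain ⟨n, hn⟩ := mem_OM.1 hf m
    exact hn.1

theorem OMSpace.contDiff (f : OMSpace 𝕜) : ContDiff ℝ ∞ f.toFun := contDiff_of_mem_OM f.2

theorem le_weight_of_le {C D x : ℝ} {n n' : ℕ} (hC : C ≤ D) (hD : 0 ≤ D) (hn : n ≤ n') :
    C * (1 + |x| ^ 2) ^ n ≤ D * (1 + |x| ^ 2) ^ n' :=
  mul_le_mul hC (pow_le_pow_right₀ (one_le_weight x) hn) (by positivity) hD

theorem exists_bound_forall_le {P : ℕ → ℝ → ℝ}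
    (h : ∀ j, ∃ (n : ℕ) (C : ℝ), ∀ x, P j x ≤ C * (1 + |x| ^ 2) ^ n) (m : ℕ) :
    ∃ (n : ℕ) (C : ℝ), 0 ≤ C ∧ ∀ j ≤ m, ∀ x, P j x ≤ C * (1 + |x| ^ 2) ^ n := by
  choose n C hC using h
  refine ⟨∑ j ∈ Finset.range (m + 1), n j, ∑ j ∈ Finset.range (m + 1), |C j|,
    Finset.sum_nonneg fun _ _ => abs_nonneg _, fun j hj x => (hC j x).trans ?_⟩
  have hj' : j ∈ Finset.range (m + 1) := Finset.mem_range.2 (Nat.lt_succ_of_le hj)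
  refine le_weight_of_le ((le_abs_self _).trans ?_)
    (Finset.sum_nonneg fun _ _ => abs_nonneg _) ?_
  · exact Finset.single_le_sum (f := fun j => |C j|) (fun _ _ => abs_nonneg _) hj'
  · exact Finset.single_le_sum (f := n) (fun _ _ => Nat.zero_le _) hj'

theorem mem_OM_of_bounds {f : ℝ → 𝕜} (hf : ContDiff ℝ ∞ f)
    (h : ∀ j, ∃ (n : ℕ) (C : ℝ), ∀ x, ‖iteratedDeriv j f x‖ ≤ C * (1 + |x| ^ 2) ^ n) :
    f ∈ OM 𝕜 := by
  refine mem_OM.2 fun m => ?_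
  obtain ⟨n, C, -, hC⟩ := exists_bound_forall_le h m
  exact ⟨n, hf.of_le (by exact_mod_cast le_top), bddAbove_weighted_iff.2 ⟨C, hC⟩⟩

theorem OMSpace.exists_bound (f : OMSpace 𝕜) (m : ℕ) :
    ∃ (n : ℕ) (C : ℝ), 0 ≤ C ∧ ∀ j ≤ m, ∀ x, ‖iteratedDeriv j f.toFun x‖ ≤
      C * (1 + |x| ^ 2) ^ n := by
  obtain ⟨n, hn⟩ := mem_OM.1 f.2 m
  exact ⟨n, omnNorm m n f.toFun, omnNorm_nonneg _ _ _, fun j hj x => le_omnNorm hn.2 hj x⟩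

theorem continuous_iteratedDeriv_of_contDiff {E : Type*} [NormedAddCommGroup E]
    [NormedSpace ℝ E] {f : ℝ → E} (hf : ContDiff ℝ ∞ f) (j : ℕ) :
    Continuous (iteratedDeriv j f) :=
  hf.continuous_iteratedDeriv j (by exact_mod_cast le_top)

theorem contDiff_iteratedDeriv {E : Type*} [NormedAddCommGroup E]
    [NormedSpace ℝ E] {f : ℝ → E} (hf : ContDiff ℝ ∞ f) (j : ℕ) :
    ContDiff ℝ ∞ (iteratedDeriv j f) := by
  induction j with
  | zero => simpa using hf
  | succ j ih =>
    rw [iteratedDeriv_succ]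
    exact (contDiff_infty_iff_deriv.1 ih).2

theorem hasCompactSupport_iteratedDeriv {E : Type*} [NormedAddCommGroup E]
    [NormedSpace ℝ E] {f : ℝ → E} (hf : HasCompactSupport f) (j : ℕ) :
    HasCompactSupport (iteratedDeriv j f) := by
  induction j with
  | zero => simpa using hf
  | succ j ih =>
    rw [iteratedDeriv_succ]
    exact ih.deriv

theorem exists_bound_of_hasCompactSupport {E : Type*} [NormedAddCommGroup E]
    [NormedSpace ℝ E] {f : ℝ → E} (hf : ContDiff ℝ ∞ f) (hc : HasCompactSupport f) (m : ℕ) :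
    ∃ C : ℝ, 0 ≤ C ∧ ∀ j ≤ m, ∀ x, ‖iteratedDeriv j f x‖ ≤ C := by
  choose C hC using fun j =>
    (continuous_iteratedDeriv_of_contDiff hf j).bounded_above_of_compact_support
    (hasCompactSupport_iteratedDeriv hc j)
  refine ⟨∑ j ∈ Finset.range (m + 1), |C j|, Finset.sum_nonneg fun _ _ => abs_nonneg _,
    fun j hj x => (hC j x).trans ((le_abs_self _).trans ?_)⟩
  exact Finset.single_le_sum (f := fun j => |C j|) (fun _ _ => abs_nonneg _)
    (Finset.mem_range.2 (Nat.lt_succ_of_le hj))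

theorem mem_OM_of_hasCompactSupport {f : ℝ → 𝕜} (hf : ContDiff ℝ ∞ f)
    (hc : HasCompactSupport f) : f ∈ OM 𝕜 :=
  mem_OM_of_bounds hf fun j => by
    obtain ⟨C, -, hC⟩ := exists_bound_of_hasCompactSupport hf hc j
    exact ⟨0, C, fun x => by simpa using hC j le_rfl x⟩

theorem OMSpace.sub_toFun (f g : OMSpace 𝕜) : (f - g).toFun = f.toFun - g.toFun := rfl

end Topology

/-! ### Density of compactly supported functions and separability. -/

section Density

variable {𝕜 : Type*} [RCLike 𝕜]

theorem norm_iteratedDeriv_smul_le {χ : ℝ → ℝ} {f : ℝ → 𝕜} (hχ : ContDiff ℝ ∞ χ)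
    (hf : ContDiff ℝ ∞ f) {m : ℕ} {x A B : ℝ} (hA : ∀ j ≤ m, ‖iteratedDeriv j χ x‖ ≤ A)
    (hB : ∀ j ≤ m, ‖iteratedDeriv j f x‖ ≤ B) :
    ∀ j ≤ m, ‖iteratedDeriv j (fun y => χ y • f y) x‖ ≤ 2 ^ m * (A * B) := by
  intro j hj
  have hA0 : 0 ≤ A := (norm_nonneg _).trans (hA 0 (Nat.zero_le _))
  have hB0 : 0 ≤ B := (norm_nonneg _).trans (hB 0 (Nat.zero_le _))
  have h := norm_iteratedFDeriv_smul_le (𝕜 := ℝ) hχ hf x (n := j) (by exact_mod_cast le_top)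
  simp only [norm_iteratedFDeriv_eq_norm_iteratedDeriv] at h
  calc ‖iteratedDeriv j (fun y => χ y • f y) x‖
      ≤ ∑ i ∈ Finset.range (j + 1), (j.choose i : ℝ) * ‖iteratedDeriv i χ x‖ *
          ‖iteratedDeriv (j - i) f x‖ := h
    _ ≤ ∑ i ∈ Finset.range (j + 1), (j.choose i : ℝ) * (A * B) := by
        refine Finset.sum_le_sum fun i hi => ?_
        have hi' : i ≤ j := Nat.lt_succ_iff.1 (Finset.mem_range.1 hi)
        rw [mul_assoc]
        gcongr
        · exact hA i (hi'.trans hj)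
        · exact hB _ ((Nat.sub_le _ _).trans hj)
    _ = 2 ^ j * (A * B) := by
        rw [← Finset.sum_mul]
        congr 1
        exact_mod_cast Nat.sum_range_choose j
    _ ≤ 2 ^ m * (A * B) := by gcongr; norm_num

/-- A standard bump function on the line, equal to `1` near the closed unit ball. -/
def baseBump : ContDiffBump (0 : ℝ) := ⟨2, 3, by norm_num, by norm_num⟩

/-- The cutoff functions `x ↦ χ(x / (R + 1))`. -/
noncomputable def cutoff (R : ℕ) (x : ℝ) : ℝ := baseBump (((R : ℝ) + 1)⁻¹ * x)

theorem contDiff_cutoff (R : ℕ) : ContDiff ℝ ∞ (cutoff R) :=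
  baseBump.contDiff.comp (contDiff_const.mul contDiff_id)

theorem cutoff_eq_one {R : ℕ} {x : ℝ} (hx : |x| ≤ R + 1) : cutoff R x = 1 := by
  refine baseBump.one_of_mem_closedBall ?_
  have hR : (0 : ℝ) < (R : ℝ) + 1 := by positivity
  rw [mem_closedBall_zero_iff, norm_mul, norm_inv, Real.norm_eq_abs, Real.norm_eq_abs,
    abs_of_pos hR, inv_mul_le_iff₀ hR]
  change |x| ≤ (R + 1) * 2
  linarith

theorem hasCompactSupport_cutoff (R : ℕ) : HasCompactSupport (cutoff R) := by
  have hR : (R : ℝ) + 1 ≠ 0 := by positivity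
  exact baseBump.hasCompactSupport.comp_homeomorph (Homeomorph.mulLeft₀ _ (inv_ne_zero hR))

theorem exists_bound_cutoff (m : ℕ) :
    ∃ C : ℝ, 0 ≤ C ∧ ∀ R, ∀ j ≤ m, ∀ x, ‖iteratedDeriv j (cutoff R) x‖ ≤ C := by
  obtain ⟨C, hC0, hC⟩ := exists_bound_of_hasCompactSupport (f := baseBump)
    baseBump.contDiff baseBump.hasCompactSupport m
  refine ⟨C, hC0, fun R j hj x => ?_⟩
  have h := iteratedDeriv_comp_const_mul (n := j) (f := baseBump) baseBump.contDiff
    (((R : ℝ) + 1)⁻¹)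
  change ‖iteratedDeriv j (fun x => baseBump (((R : ℝ) + 1)⁻¹ * x)) x‖ ≤ C
  rw [h, norm_mul, norm_pow, norm_inv]
  have h1 : ‖(R : ℝ) + 1‖⁻¹ ≤ 1 := by
    rw [Real.norm_eq_abs, abs_of_pos (by positivity)]
    exact inv_le_one_of_one_le₀ (by linarith [(Nat.cast_nonneg R : (0 : ℝ) ≤ R)])
  exact (mul_le_of_le_one_left (norm_nonneg _) (pow_le_one₀ (by positivity) h1)).trans (hC j hj _)

/-- An element of `𝒪_M(ℝ)` from its underlying function. -/
def OMSpace.mk (f : ℝ → 𝕜) (hf : f ∈ OM 𝕜) : OMSpace 𝕜 := ⟨f, hf⟩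

@[simp]
theorem OMSpace.mk_toFun (f : ℝ → 𝕜) (hf : f ∈ OM 𝕜) : (OMSpace.mk f hf).toFun = f := rfl

theorem OMSpace.ext_toFun {f g : OMSpace 𝕜} (h : f.toFun = g.toFun) : f = g := Subtype.ext h

theorem hasCompactSupport_cutoff_smul (R : ℕ) (f : ℝ → 𝕜) :
    HasCompactSupport fun x => cutoff R x • f x :=
  (hasCompactSupport_cutoff R).smul_right

theorem contDiff_cutoff_smul (R : ℕ) {f : ℝ → 𝕜} (hf : ContDiff ℝ ∞ f) :
    ContDiff ℝ ∞ fun x => cutoff R x • f x :=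
  (contDiff_cutoff R).smul hf

/-- The smooth function `f` cut off to a compact set. -/
noncomputable def cutoffOM (R : ℕ) (f : ℝ → 𝕜) (hf : ContDiff ℝ ∞ f) : OMSpace 𝕜 :=
  OMSpace.mk (fun x => cutoff R x • f x) (mem_OM_of_hasCompactSupport (contDiff_cutoff_smul R hf)
    (hasCompactSupport_cutoff_smul R f))

theorem tendsto_cutoffOM (f : OMSpace 𝕜) :
    Tendsto (fun R => cutoffOM R f.toFun f.contDiff) atTop (𝓝 f) := by
  refine tendsto_of_norm_le fun m => ?_
  obtain ⟨n, B, hB0, hB⟩ := f.exists_bound m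
  obtain ⟨A, hA0, hA⟩ := exists_bound_cutoff m
  -- The error lives on `|x| ≥ R + 1`, where one extra factor `1 + |x|²` absorbs any constant once
  -- `R` is large.
  refine ⟨n + 1, fun ε hε => ?_⟩
  obtain ⟨N, hN⟩ := exists_nat_gt ((2 ^ m * (A * B) + B) / ε)
  filter_upwards [eventually_ge_atTop N] with R hR j hj x
  have hc := contDiff_cutoff_smul R f.contDiff
  by_cases hx : |x| < R + 1
  · have : (cutoffOM R f.toFun f.contDiff - f).toFun =ᶠ[𝓝 x] fun _ => 0 := by
      filter_upwards [(isOpen_lt continuous_abs continuous_const).mem_nhds hx] with y hy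
      change cutoff R y • f.toFun y - f.toFun y = 0
      rw [cutoff_eq_one (le_of_lt hy), one_smul, sub_self]
    rw [this.iteratedDeriv_eq j]
    simp only [iteratedDeriv_const, ite_self, norm_zero]
    positivity
  · have hx' : (R : ℝ) + 1 ≤ |x| := not_lt.1 hx
    have e : (cutoffOM R f.toFun f.contDiff - f).toFun =
      (fun x => cutoff R x • f.toFun x) - f.toFun := rfl
    rw [e, iteratedDeriv_sub (hc.contDiffAt.of_le (by exact_mod_cast le_top))
      (f.contDiff.contDiffAt.of_le (by exact_mod_cast le_top))]
    have h1 := norm_iteratedDeriv_smul_le (contDiff_cutoff R) f.contDiff (m := m) (x := x)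
      (fun j hj => hA R j hj x) (fun j hj => hB j hj x) j hj
    have hN' : 2 ^ m * (A * B) + B ≤ ε * (1 + |x| ^ 2) := by
      rw [div_lt_iff₀ hε] at hN
      have : (N : ℝ) ≤ R := by exact_mod_cast hR
      have : (N : ℝ) ≤ 1 + |x| ^ 2 := by nlinarith
      nlinarith
    calc _ ≤ _ := norm_sub_le _ _
      _ ≤ 2 ^ m * (A * (B * (1 + |x| ^ 2) ^ n)) + B * (1 + |x| ^ 2) ^ n :=
          add_le_add h1 (hB j hj x)
      _ = (2 ^ m * (A * B) + B) * (1 + |x| ^ 2) ^ n := by ring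
      _ ≤ (ε * (1 + |x| ^ 2)) * (1 + |x| ^ 2) ^ n := by gcongr
      _ = _ := by ring

theorem dense_hasCompactSupport :
    Dense {f : OMSpace 𝕜 | HasCompactSupport f.toFun} := fun f =>
  mem_closure_of_tendsto (tendsto_cutoffOM f)
    (Eventually.of_forall fun R => hasCompactSupport_cutoff_smul R f.toFun)

/-- The set of all jets `(f⁽ʲ⁾)_j` of smooth functions. -/
def smoothJets (𝕜 : Type*) [RCLike 𝕜] : Set (ℕ → C(ℝ, 𝕜)) :=
  {F | ∃ f : ℝ → 𝕜, ContDiff ℝ ∞ f ∧ ∀ j, ⇑(F j) = iteratedDeriv j f}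

/-- Smooth jets form a subspace of the second countable space `ℕ → C(ℝ, 𝕜)`, so countably many
smooth functions approximate all others, locally uniformly with all derivatives. Multiplied by a
fixed cutoff this becomes convergence in `𝒪_M`, and letting the cutoff radius grow reaches every
element. -/
theorem exists_denseRange_hasCompactSupport (𝕜 : Type*) [RCLike 𝕜] :
    ∃ g : ℕ → OMSpace 𝕜, (∀ k, HasCompactSupport (g k).toFun) ∧ DenseRange g := by
  have hne : Nonempty (smoothJets 𝕜) := by
    refine ⟨⟨fun _ => 0, fun _ => 0, contDiff_const, fun j => ?_⟩⟩
    funext x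
    simp
  choose φ hφ hφ' using fun i => (TopologicalSpace.denseSeq (smoothJets 𝕜) i).2
  refine ⟨fun k => cutoffOM k.unpair.1 (φ k.unpair.2) (hφ _),
    fun k => hasCompactSupport_cutoff_smul _ _, fun f => ?_⟩
  refine isClosed_closure.mem_of_tendsto (tendsto_cutoffOM f) (Eventually.of_forall fun R => ?_)
  let F : smoothJets 𝕜 := ⟨fun j => ⟨iteratedDeriv j f.toFun,
    continuous_iteratedDeriv_of_contDiff f.contDiff j⟩, f.toFun, f.contDiff, fun j => rfl⟩
  obtain ⟨s, hs, hsF⟩ := mem_closure_iff_seq_limit.1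
    (TopologicalSpace.denseRange_denseSeq (smoothJets 𝕜) F)
  choose i hi using hs
  have hlim : ∀ j, TendstoUniformlyOn (fun l => iteratedDeriv j (φ (i l)))
      (iteratedDeriv j f.toFun) atTop (tsupport (cutoff R)) := by
    intro j
    have h1 : Tendsto (fun l => (s l).1 j) atTop (𝓝 (F.1 j)) :=
      ((continuous_apply j).tendsto _).comp ((continuous_subtype_val.tendsto _).comp hsF)
    have h2 := (ContinuousMap.tendsto_iff_forall_isCompact_tendstoUniformlyOn.1 h1) _
      (hasCompactSupport_cutoff R)
    refine h2.congr (Eventually.of_forall fun l x _ => ?_)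
    change (s l).1 j x = _
    rw [← hφ', hi]
  refine mem_closure_of_tendsto (f := fun l => cutoffOM R (φ (i l)) (hφ _)) (b := atTop) ?_
    (Eventually.of_forall fun l => ⟨Nat.pair R (i l), by simp⟩)
  refine tendsto_of_norm_le fun m => ⟨0, fun ε hε => ?_⟩
  obtain ⟨A, hA0, hA⟩ := exists_bound_cutoff m
  have hev : ∀ᶠ l in atTop, ∀ j ∈ Finset.range (m + 1), ∀ x ∈ tsupport (cutoff R),
      dist (iteratedDeriv j f.toFun x) (iteratedDeriv j (φ (i l)) x) < ε / (2 ^ m * (A + 1)) :=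
    (Finset.eventually_all _).2 fun j _ =>
      Metric.tendstoUniformlyOn_iff.1 (hlim j) _ (by positivity)
  filter_upwards [hev] with l hl j hj x
  have e : (cutoffOM R (φ (i l)) (hφ _) - cutoffOM R f.toFun f.contDiff).toFun =
      fun x => cutoff R x • (φ (i l) - f.toFun) x := by
    funext x
    exact (smul_sub _ _ _).symm
  rw [e, pow_zero, mul_one]
  by_cases hx : x ∈ tsupport (cutoff R)
  · have h1 := norm_iteratedDeriv_smul_le (contDiff_cutoff R) ((hφ (i l)).sub f.contDiff)
      (m := m) (x := x) (B := ε / (2 ^ m * (A + 1))) (fun j hj => hA R j hj x)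
      (fun j hj => by
        rw [← Pi.sub_def, iteratedDeriv_sub ((hφ _).contDiffAt.of_le (by exact_mod_cast le_top))
          (f.contDiff.contDiffAt.of_le (by exact_mod_cast le_top)), ← dist_eq_norm, dist_comm]
        exact (hl j (Finset.mem_range.2 (Nat.lt_succ_of_le hj)) x hx).le) j hj
    refine h1.trans ?_
    rw [← mul_assoc, mul_div_assoc', div_le_iff₀ (by positivity)]
    nlinarith [mul_pos hε (pow_pos (zero_lt_two' ℝ) m)]
  · have : (fun x => cutoff R x • (φ (i l) - f.toFun) x) =ᶠ[𝓝 x] fun _ => 0 := by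
      filter_upwards [(isClosed_tsupport _).isOpen_compl.mem_nhds hx] with y hy
      rw [image_eq_zero_of_notMem_tsupport hy, zero_smul]
    rw [this.iteratedDeriv_eq j]
    simp only [iteratedDeriv_const, ite_self, norm_zero]
    positivity

end Density

/-! ### The translation operator: dense periodic points and a hypercyclic vector. -/

section Translation

variable {𝕜 : Type*} [RCLike 𝕜]

theorem compOp_iterate_toFun {ψ : ℝ → ℝ} (hψ : ψ ∈ OM ℝ) (n : ℕ) (f : OMSpace 𝕜) :
    ((compOp 𝕜 ψ hψ)^[n] f).toFun = f.toFun ∘ ψ^[n] := by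
  induction n generalizing f with
  | zero => rfl
  | succ n ih =>
    rw [Function.iterate_succ_apply, ih, Function.iterate_succ']
    rfl

theorem iterate_add_one (n : ℕ) (x : ℝ) : (fun x : ℝ => x + 1)^[n] x = x + n := by
  simp

theorem exists_nat_support_subset {f : ℝ → 𝕜} (hf : HasCompactSupport f) :
    ∃ R : ℕ, ∀ x, (R : ℝ) ≤ |x| → f x = 0 := by
  obtain ⟨r, hr⟩ := hf.isBounded.subset_closedBall (0 : ℝ)
  obtain ⟨R, hR⟩ := exists_nat_gt r
  refine ⟨R, fun x hx => ?_⟩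
  by_contra h
  have := hr (subset_tsupport f h)
  rw [mem_closedBall_zero_iff, Real.norm_eq_abs] at this
  linarith

/-- The `N`-periodic function that agrees with `f` on a period around `0`. -/
noncomputable def periodize {E : Type*} (N : ℕ) (f : ℝ → E) (x : ℝ) : E := f (x - N * round (x / N))

theorem periodize_add {E : Type*} {N : ℕ} (hN : 0 < N) (f : ℝ → E) (x : ℝ) :
    periodize N f (x + N) = periodize N f x := by
  have hN' : (N : ℝ) ≠ 0 := by positivity
  unfold periodize
  rw [add_div, div_self hN', round_add_one]
  push_cast
  ring_nf

theorem abs_sub_mul_round_le {N : ℕ} (hN : 0 < N) (x : ℝ) :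
    |x - N * round (x / N)| ≤ N / 2 := by
  have hN' : (0 : ℝ) < N := by positivity
  have h := abs_sub_round (x / N)
  have e : x - N * round (x / N) = N * (x / N - round (x / N)) := by field_simp
  rw [e, abs_mul, abs_of_pos hN']
  nlinarith

/-- The rounded integer may jump near `x`, but only at points at least `N / 4 ≥ R` away from all
multiples of `N`, where both sides vanish. This makes the periodization smooth. -/
theorem periodize_eventuallyEq {N R : ℕ} (hN : 0 < N) (hR : 4 * R ≤ N) {f : ℝ → 𝕜}
    (hf : ∀ x, (R : ℝ) ≤ |x| → f x = 0) (x : ℝ) :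
    periodize N f =ᶠ[𝓝 x] fun y => f (y - N * round (x / N)) := by
  have hN' : (0 : ℝ) < N := by positivity
  have hR' : 4 * (R : ℝ) ≤ N := by exact_mod_cast hR
  filter_upwards [Metric.ball_mem_nhds x (show (0 : ℝ) < N / 4 by positivity)] with y hy
  rw [Metric.mem_ball, Real.dist_eq] at hy
  by_cases h : round (y / N) = round (x / N)
  · rw [periodize, h]
  have h1 : (N : ℝ) ≤ |(N : ℝ) * round (y / N) - N * round (x / N)| := by
    rw [← mul_sub, abs_mul, abs_of_pos hN']
    have : (1 : ℝ) ≤ |(round (y / N) : ℝ) - round (x / N)| := by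
      exact_mod_cast Int.one_le_abs (sub_ne_zero.2 h)
    nlinarith
  have hy2 := abs_sub_mul_round_le hN y
  have hx2 := abs_sub_mul_round_le hN x
  rw [periodize, hf, hf]
  · have := abs_sub_abs_le_abs_sub ((N : ℝ) * round (y / N) - N * round (x / N))
      (-(y - N * round (y / N)))
    rw [abs_neg] at this
    have e : (N : ℝ) * round (y / N) - N * round (x / N) - -(y - N * round (y / N)) =
      y - N * round (x / N) := by ring
    rw [e] at this
    linarith
  · have h3 := abs_sub_abs_le_abs_sub ((N : ℝ) * round (y / N) - N * round (x / N))
      (y - x + (x - N * round (x / N)))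
    have h4 := abs_add_le (y - x) (x - N * round (x / N))
    have e : (N : ℝ) * round (y / N) - N * round (x / N) - (y - x + (x - N * round (x / N))) =
      -(y - N * round (y / N)) := by ring
    rw [e, abs_neg] at h3
    linarith

theorem contDiff_periodize {N R : ℕ} (hN : 0 < N) (hR : 4 * R ≤ N) {f : ℝ → 𝕜}
    (hf : ∀ x, (R : ℝ) ≤ |x| → f x = 0) (hc : ContDiff ℝ ∞ f) :
    ContDiff ℝ ∞ (periodize N f) :=
  contDiff_iff_contDiffAt.2 fun x =>
    ((hc.comp (contDiff_id.sub contDiff_const)).contDiffAt).congr_of_eventuallyEq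
      (periodize_eventuallyEq hN hR hf x)

theorem norm_iteratedDeriv_periodize_le {N R : ℕ} (hN : 0 < N) (hR : 4 * R ≤ N) {f : ℝ → 𝕜}
    (hf : ∀ x, (R : ℝ) ≤ |x| → f x = 0) {j : ℕ} {C : ℝ} (hC : ∀ x, ‖iteratedDeriv j f x‖ ≤ C)
    (x : ℝ) : ‖iteratedDeriv j (periodize N f) x‖ ≤ C := by
  rw [(periodize_eventuallyEq hN hR hf x).iteratedDeriv_eq j, iteratedDeriv_comp_sub_const]
  exact hC _

/-- Periodizing a compactly supported `f` with period `N → ∞` changes it only where `|x| ≥ N / 2`.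
The change has derivatives bounded independently of `N`, so it tends to zero in the norms of weight
exponent `1`. -/
theorem dense_periodicPts_translation (𝕜 : Type*) [RCLike 𝕜] :
    Dense (Function.periodicPts (compOp 𝕜 (fun x => x + 1) add_one_mem_OM)) := by
  refine dense_closure.1 (dense_hasCompactSupport.mono fun f (hf : HasCompactSupport f.toFun) => ?_)
  obtain ⟨R, hR⟩ := exists_nat_support_subset hf
  have hpos : ∀ k : ℕ, 0 < 4 * R + 1 + k := fun k => by omega
  have hle : ∀ k : ℕ, 4 * R ≤ 4 * R + 1 + k := fun k => by omega
  have hmem : ∀ k : ℕ, periodize (4 * R + 1 + k) f.toFun ∈ OM 𝕜 := fun k =>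
    mem_OM_of_bounds (contDiff_periodize (hpos k) (hle k) hR f.contDiff) fun j => by
      obtain ⟨C, -, hC⟩ := exists_bound_of_hasCompactSupport f.contDiff hf j
      exact ⟨0, C, fun x => by
        simpa using norm_iteratedDeriv_periodize_le (hpos k) (hle k) hR (hC j le_rfl) x⟩
  refine mem_closure_of_tendsto (f := fun k => OMSpace.mk _ (hmem k)) (b := atTop) ?_
    (Eventually.of_forall fun k => ?_)
  · refine tendsto_of_norm_le fun m => ⟨1, fun ε hε => ?_⟩
    obtain ⟨C, hC0, hC⟩ := exists_bound_of_hasCompactSupport f.contDiff hf m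
    obtain ⟨K, hK⟩ := exists_nat_gt (2 * (2 * C) / ε)
    filter_upwards [eventually_ge_atTop K] with k hk j hj x
    set N := 4 * R + 1 + k with hNdef
    have hN' : (0 : ℝ) < N := by exact_mod_cast hpos k
    have e : (OMSpace.mk _ (hmem k) - f).toFun = periodize N f.toFun - f.toFun := rfl
    rw [e]
    by_cases hx : round (x / N) = 0
    · have : periodize N f.toFun - f.toFun =ᶠ[𝓝 x] fun _ => 0 := by
        filter_upwards [periodize_eventuallyEq (hpos k) (hle k) hR x] with y hy
        rw [Pi.sub_apply, hy, hx]
        simp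
      rw [this.iteratedDeriv_eq j]
      simp only [iteratedDeriv_const, ite_self, norm_zero]
      positivity
    · rw [iteratedDeriv_sub ((contDiff_periodize (hpos k) (hle k) hR f.contDiff).contDiffAt.of_le
        (by exact_mod_cast le_top)) (f.contDiff.contDiffAt.of_le (by exact_mod_cast le_top))]
      have h1 := norm_iteratedDeriv_periodize_le (hpos k) (hle k) hR (hC j hj) x
      have h2 : (N : ℝ) / 2 ≤ |x| := by
        have h3 := abs_sub_mul_round_le (hpos k) x
        have h4 : (N : ℝ) ≤ |(N : ℝ) * round (x / N)| := by
          rw [abs_mul, abs_of_pos hN']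
          have : (1 : ℝ) ≤ |(round (x / N) : ℝ)| := by exact_mod_cast Int.one_le_abs hx
          nlinarith
        have h5 := abs_sub_abs_le_abs_sub ((N : ℝ) * round (x / N)) x
        rw [abs_sub_comm] at h5
        linarith
      have h6 : (K : ℝ) ≤ N := by
        have : K ≤ N := by omega
        exact_mod_cast this
      have h7 : (K : ℝ) / 2 ≤ 1 + |x| ^ 2 := by nlinarith [sq_nonneg (|x| - 1)]
      rw [div_lt_iff₀ hε] at hK
      calc _ ≤ _ := norm_sub_le _ _
        _ ≤ C + C := add_le_add h1 (hC j hj x)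
        _ ≤ ε * (1 + |x| ^ 2) ^ 1 := by
            rw [pow_one]
            nlinarith
  · refine ⟨4 * R + 1 + k, hpos k, OMSpace.ext_toFun ?_⟩
    rw [compOp_iterate_toFun]
    funext x
    simp only [Function.comp_apply, iterate_add_one, OMSpace.mk_toFun]
    exact periodize_add (hpos k) _ x

/-- Positions that separate the supports of a sequence of functions with gaps `b`. -/
def gapSum (b : ℕ → ℕ) (k : ℕ) : ℕ := ∑ i ∈ Finset.range k, b i + ∑ i ∈ Finset.range (k + 1), b i

theorem gapSum_add_le (b : ℕ → ℕ) {l k : ℕ} (h : l < k) : gapSum b l + b l + b k ≤ gapSum b k := by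
  have h1 : ∑ i ∈ Finset.range (l + 1), b i ≤ ∑ i ∈ Finset.range k, b i :=
    Finset.sum_le_sum_of_subset (Finset.range_mono h)
  rw [gapSum, gapSum, Finset.sum_range_succ _ k]
  rw [Finset.sum_range_succ _ l] at h1 ⊢
  omega

theorem le_abs_gapSum_sub (b : ℕ → ℕ) {l k : ℕ} (h : l ≠ k) :
    (b l : ℝ) + b k ≤ |(gapSum b l : ℝ) - gapSum b k| := by
  rcases lt_or_gt_of_ne h with h | h
  · have : (gapSum b l : ℝ) + b l + b k ≤ gapSum b k := by exact_mod_cast gapSum_add_le b h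
    rw [abs_sub_comm]
    exact le_trans (by linarith) (le_abs_self _)
  · have : (gapSum b k : ℝ) + b k + b l ≤ gapSum b l := by exact_mod_cast gapSum_add_le b h
    exact le_trans (by linarith) (le_abs_self _)

theorem le_gapSum (b : ℕ → ℕ) (k : ℕ) : b k ≤ gapSum b k := by
  rw [gapSum, Finset.sum_range_succ]
  omega

/-- The superposition of the translates of the functions `G l` to the positions `a l`. -/
noncomputable def superpose (G : ℕ → ℝ → 𝕜) (a : ℕ → ℕ) (x : ℝ) : 𝕜 := ∑ᶠ l, G l (x - a l)

theorem superpose_eventuallyEq {G : ℕ → ℝ → 𝕜} {R b : ℕ → ℕ}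
    (hG : ∀ l x, (R l : ℝ) ≤ |x| → G l x = 0) (hb : ∀ l, R l + 1 ≤ b l) {x : ℝ} {l : ℕ}
    (hl : |x - gapSum b l| < R l + 1 / 4) :
    superpose G (gapSum b) =ᶠ[𝓝 x] fun y => G l (y - gapSum b l) := by
  filter_upwards [Metric.ball_mem_nhds x (show (0 : ℝ) < 1 / 4 by norm_num)] with y hy
  rw [Metric.mem_ball, Real.dist_eq] at hy
  refine finsum_eq_single _ l fun l' hl' => hG l' _ ?_
  have h1 := le_abs_gapSum_sub b hl'
  have h2 : (R l : ℝ) + 1 ≤ b l := by exact_mod_cast hb l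
  have h3 : (R l' : ℝ) + 1 ≤ b l' := by exact_mod_cast hb l'
  have h4 : |(gapSum b l' : ℝ) - gapSum b l| ≤
      |y - gapSum b l'| + |y - x| + |x - gapSum b l| := by
    have e : (gapSum b l' : ℝ) - gapSum b l =
      -(y - gapSum b l') + (y - x) + (x - gapSum b l) := by ring
    rw [e]
    refine (abs_add_three _ _ _).trans ?_
    rw [abs_neg]
  linarith

theorem superpose_eventuallyEq_zero {G : ℕ → ℝ → 𝕜} {R b : ℕ → ℕ}
    (hG : ∀ l x, (R l : ℝ) ≤ |x| → G l x = 0) {x : ℝ}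
    (hl : ∀ l, (R l : ℝ) + 1 / 4 ≤ |x - gapSum b l|) :
    superpose G (gapSum b) =ᶠ[𝓝 x] fun _ => 0 := by
  filter_upwards [Metric.ball_mem_nhds x (show (0 : ℝ) < 1 / 4 by norm_num)] with y hy
  rw [Metric.mem_ball, Real.dist_eq] at hy
  refine finsum_eq_zero_of_forall_eq_zero fun l => hG l _ ?_
  have h := abs_add_le (x - y) (y - gapSum b l)
  rw [sub_add_sub_cancel, abs_sub_comm x y] at h
  linarith [hl l]

theorem contDiff_superpose {G : ℕ → ℝ → 𝕜} {R b : ℕ → ℕ} (hc : ∀ l, ContDiff ℝ ∞ (G l))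
    (hG : ∀ l x, (R l : ℝ) ≤ |x| → G l x = 0) (hb : ∀ l, R l + 1 ≤ b l) :
    ContDiff ℝ ∞ (superpose G (gapSum b)) := by
  refine contDiff_iff_contDiffAt.2 fun x => ?_
  by_cases h : ∃ l, |x - gapSum b l| < R l + 1 / 4
  · obtain ⟨l, hl⟩ := h
    exact (((hc l).comp (contDiff_id.sub contDiff_const)).contDiffAt).congr_of_eventuallyEq
      (superpose_eventuallyEq hG hb hl)
  · push Not at h
    exact contDiffAt_const.congr_of_eventuallyEq (superpose_eventuallyEq_zero hG h)

/-- A pointwise bound for the derivatives of the superposition: they vanish off the translated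
supports, and are bounded by `M l` up to a constant on the `l`-th one. -/
theorem norm_iteratedDeriv_superpose_le {G : ℕ → ℝ → 𝕜} {R b M : ℕ → ℕ}
    (hc : ∀ l, ContDiff ℝ ∞ (G l)) (hG : ∀ l x, (R l : ℝ) ≤ |x| → G l x = 0)
    (hb : ∀ l, R l + 1 ≤ b l) (hM : ∀ l, ∀ j ≤ l, ∀ x, ‖iteratedDeriv j (G l) x‖ ≤ M l) (m : ℕ) :
    ∃ B : ℝ, 0 ≤ B ∧ ∀ j ≤ m, ∀ x, iteratedDeriv j (superpose G (gapSum b)) x = 0 ∨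
      ∃ l, |x - gapSum b l| < R l + 1 / 4 ∧
        ‖iteratedDeriv j (superpose G (gapSum b)) x‖ ≤ B + M l := by
  have hcs : ∀ l, HasCompactSupport (G l) := fun l =>
    HasCompactSupport.of_support_subset_isCompact (isCompact_closedBall (0 : ℝ) (R l))
      fun x hx => by
        rw [mem_closedBall_zero_iff, Real.norm_eq_abs]
        by_contra h
        exact hx (hG l x (not_le.1 h).le)
  choose C hC0 hC using fun l => exists_bound_of_hasCompactSupport (hc l) (hcs l) m
  -- The sum covers the finitely many `l < m`, for which `M l` controls too few derivatives.
  refine ⟨∑ l ∈ Finset.range m, C l, Finset.sum_nonneg fun _ _ => hC0 _, fun j hj x => ?_⟩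
  by_cases h : ∃ l, |x - gapSum b l| < R l + 1 / 4
  · obtain ⟨l, hl⟩ := h
    refine Or.inr ⟨l, hl, ?_⟩
    rw [(superpose_eventuallyEq hG hb hl).iteratedDeriv_eq j, iteratedDeriv_comp_sub_const]
    rcases lt_or_ge l m with hlm | hlm
    · have h1 := Finset.single_le_sum (f := C) (fun i _ => hC0 i) (Finset.mem_range.2 hlm)
      have h2 : (0 : ℝ) ≤ M l := Nat.cast_nonneg _
      linarith [hC l j hj (x - gapSum b l)]
    · have h1 : 0 ≤ ∑ l ∈ Finset.range m, C l := Finset.sum_nonneg fun _ _ => hC0 _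
      linarith [hM l j (hj.trans hlm) (x - gapSum b l)]
  · push Not at h
    left
    rw [(superpose_eventuallyEq_zero hG h).iteratedDeriv_eq j]
    simp

theorem isHypercyclic_translation (𝕜 : Type*) [RCLike 𝕜] :
    IsHypercyclic (compOp 𝕜 (fun x => x + 1) add_one_mem_OM) := by
  obtain ⟨g, hgc, hg⟩ := exists_denseRange_hasCompactSupport 𝕜
  -- Unpairing makes every `g i` occur at the infinitely many indices `Nat.pair i p`.
  set G : ℕ → ℝ → 𝕜 := fun k => (g k.unpair.1).toFun with hGdef
  have hc : ∀ l, ContDiff ℝ ∞ (G l) := fun l => (g _).contDiff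
  choose R hR using fun l => exists_nat_support_subset (hgc (Nat.unpair l).1)
  have hM : ∀ l, ∃ M : ℕ, ∀ j ≤ l, ∀ x, ‖iteratedDeriv j (G l) x‖ ≤ M := fun l => by
    obtain ⟨C, -, hC⟩ := exists_bound_of_hasCompactSupport (hc l) (hgc _) l
    obtain ⟨M, hM⟩ := exists_nat_ge C
    exact ⟨M, fun j hj x => (hC j hj x).trans hM⟩
  choose M hM using hM
  -- The gap exceeds the supports by `M l + l`. The part `M l` makes the size of the `l`-th block at
  -- most its distance from the origin, so the sum lies in `𝒪_M`; the part `l` sends the other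
  -- blocks to infinity after shifting the `k`-th one home.
  set b : ℕ → ℕ := fun l => 2 * R l + M l + l + 1 with hbdef
  have hb : ∀ l, R l + 1 ≤ b l := fun l => by simp only [hbdef]; omega
  have hb' : ∀ l, (b l : ℝ) = 2 * R l + M l + l + 1 := fun l => by simp [hbdef]
  set S := superpose G (gapSum b) with hS
  have hSc : ContDiff ℝ ∞ S := contDiff_superpose hc hR hb
  have hbound := norm_iteratedDeriv_superpose_le hc hR hb hM
  have hmem : S ∈ OM 𝕜 := by
    refine mem_OM_of_bounds hSc fun j => ?_
    obtain ⟨B, hB0, hB⟩ := hbound j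
    refine ⟨1, B + 1, fun x => ?_⟩
    have hx : (0 : ℝ) ≤ |x| ^ 2 := by positivity
    rcases hB j le_rfl x with h | ⟨l, hl, h⟩
    · rw [h, norm_zero]
      positivity
    · refine h.trans ?_
      have h1 : (b l : ℝ) ≤ gapSum b l := by exact_mod_cast le_gapSum b l
      have h2 : (M l : ℝ) ≤ |x| := by
        have h3 := (abs_lt.1 hl).1
        have h4 := le_abs_self x
        have h5 := hb' l
        have h6 : (0 : ℝ) ≤ R l := Nat.cast_nonneg _
        have h7 : (0 : ℝ) ≤ l := Nat.cast_nonneg _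
        linarith
      rw [pow_one]
      nlinarith [sq_nonneg (|x| - 1)]
  refine ⟨OMSpace.mk S hmem, dense_closure.1 (hg.mono ?_)⟩
  rintro _ ⟨i, rfl⟩
  refine mem_closure_of_tendsto (b := atTop)
    (f := fun p : ℕ => (compOp 𝕜 (fun x => x + 1) add_one_mem_OM)^[gapSum b (Nat.pair i p)]
      (OMSpace.mk S hmem)) ?_ (Eventually.of_forall fun p => ⟨_, rfl⟩)
  refine tendsto_of_norm_le fun m => ⟨1, fun ε hε => ?_⟩
  obtain ⟨B, hB0, hB⟩ := hbound m
  obtain ⟨K, hK⟩ := exists_nat_gt ((B + 1) / ε)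
  filter_upwards [eventually_ge_atTop (K + 1)] with p hp j hj x
  set k := Nat.pair i p with hk
  have hkK : (K : ℝ) + 1 ≤ k := by exact_mod_cast hp.trans (Nat.right_le_pair i p)
  have hGk : G k = (g i).toFun := by simp [hGdef, hk]
  set F := (compOp 𝕜 (fun x => x + 1) add_one_mem_OM)^[gapSum b k] (OMSpace.mk S hmem) with hF
  have hFS : F.toFun = fun y => S (y + gapSum b k) := by
    rw [hF, compOp_iterate_toFun]
    funext y
    simp only [Function.comp_apply, iterate_add_one, OMSpace.mk_toFun]
  have e : (F - g i).toFun = (fun y => S (y + gapSum b k)) - G k := by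
    rw [OMSpace.sub_toFun, hFS, hGk]
  rw [e]
  by_cases hx : |x| < R k + 1 / 4
  · have h0 : (fun y => S (y + gapSum b k)) - G k =ᶠ[𝓝 x] fun _ => 0 := by
      have h1 := superpose_eventuallyEq hR hb (x := x + gapSum b k) (l := k) (by simpa using hx)
      have h2 : Tendsto (fun y : ℝ => y + gapSum b k) (𝓝 x) (𝓝 (x + gapSum b k)) :=
        (continuous_id.add continuous_const).tendsto x
      filter_upwards [h2.eventually h1] with y hy
      rw [Pi.sub_apply, hS, hy, add_sub_cancel_right, sub_self]
    rw [h0.iteratedDeriv_eq j]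
    simp only [iteratedDeriv_const, ite_self, norm_zero]
    positivity
  · have hx' : (R k : ℝ) + 1 / 4 ≤ |x| := not_lt.1 hx
    have h0 : (fun y => S (y + gapSum b k)) - G k =ᶠ[𝓝 x] fun y => S (y + gapSum b k) := by
      filter_upwards [Metric.ball_mem_nhds x (show (0 : ℝ) < 1 / 4 by norm_num)] with y hy
      rw [Metric.mem_ball, Real.dist_eq] at hy
      have h := abs_sub_abs_le_abs_sub x y
      rw [abs_sub_comm x y] at h
      rw [Pi.sub_apply, show G k y = 0 from hR k y (by linarith), sub_zero]
    rw [h0.iteratedDeriv_eq j, iteratedDeriv_comp_add_const, pow_one]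
    beta_reduce
    rcases hB j hj (x + gapSum b k) with h | ⟨l, hl, h⟩
    · simp only [← hS] at h
      rw [h, norm_zero]
      positivity
    · refine h.trans ?_
      have hlk : l ≠ k := by
        rintro rfl
        rw [add_sub_cancel_right] at hl
        linarith
      have h1 := le_abs_gapSum_sub b hlk
      have h2 := abs_sub_abs_le_abs_sub ((gapSum b l : ℝ) - gapSum b k) (x)
      have e2 : (gapSum b l : ℝ) - gapSum b k - x = -(x + gapSum b k - gapSum b l) := by ring
      rw [e2, abs_neg] at h2
      -- After the shift by `gapSum b k`, a foreign block of size `M l` is met only at distance at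
      -- least `k + M l + 1`, so `1 + |x|²` dominates `k (1 + M l)`.
      have h3 : (k : ℝ) + M l + 1 ≤ |x| := by
        have h5 := hb' l
        have h5' := hb' k
        have h6 : (0 : ℝ) ≤ R l := Nat.cast_nonneg _
        have h6' : (0 : ℝ) ≤ R k := Nat.cast_nonneg _
        have h7 : (0 : ℝ) ≤ l := Nat.cast_nonneg _
        have h8 : (0 : ℝ) ≤ M k := Nat.cast_nonneg _
        linarith
      have h9 : (0 : ℝ) ≤ M l := Nat.cast_nonneg _
      have hK0 : (0 : ℝ) ≤ K := Nat.cast_nonneg _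
      have h10 : (K : ℝ) * (1 + M l) ≤ 1 + |x| ^ 2 := by
        nlinarith [mul_nonneg hK0 h9]
      rw [div_lt_iff₀ hε] at hK
      calc B + M l ≤ (B + 1) * (1 + M l) := by nlinarith
        _ ≤ (K * ε) * (1 + M l) := by gcongr
        _ = ε * (K * (1 + M l)) := by ring
        _ ≤ ε * (1 + |x| ^ 2) := by gcongr

end Translation

/-! ### Smooth Abel functions of fixed-point-free diffeomorphisms of the line. -/

section Abel

theorem contDiff_zpow {e : Equiv.Perm ℝ} (he : ContDiff ℝ ∞ e) (he' : ContDiff ℝ ∞ e.symm)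
    (n : ℤ) : ContDiff ℝ ∞ ⇑(e ^ n) := by
  induction n using Int.induction_on with
  | zero => exact contDiff_id
  | succ n ih =>
    rw [zpow_add_one]
    exact ih.comp he
  | pred n ih =>
    rw [zpow_sub_one]
    exact ih.comp he'

theorem strictMono_zpow {e : Equiv.Perm ℝ} (he : StrictMono e) (n : ℤ) : StrictMono ⇑(e ^ n) := by
  have he' : StrictMono ⇑e⁻¹ := fun x y hxy => he.lt_iff_lt.1 (by simpa using hxy)
  induction n using Int.induction_on with
  | zero => exact strictMono_id
  | succ n ih =>
    rw [zpow_add_one]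
    exact ih.comp he
  | pred n ih =>
    rw [zpow_sub_one]
    exact ih.comp he'

theorem deriv_perm_ne_zero {e : Equiv.Perm ℝ} (he : ContDiff ℝ ∞ e)
    (he' : ContDiff ℝ ∞ e.symm) (x : ℝ) : deriv e x ≠ 0 := by
  intro h
  have h1 : HasDerivAt e 0 x := h ▸ (he.differentiable (by simp) x).hasDerivAt
  have h2 := (he'.differentiable (by simp) (e x)).hasDerivAt.comp x h1
  have h3 : ⇑e.symm ∘ ⇑e = id := by funext y; simp
  rw [h3] at h2
  simpa using h2.unique (hasDerivAt_id x)

theorem deriv_zpow_pos {e : Equiv.Perm ℝ} (he : ContDiff ℝ ∞ e) (he' : ContDiff ℝ ∞ e.symm)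
    (hm : StrictMono e) (n : ℤ) (x : ℝ) : 0 < deriv ⇑(e ^ n) x := by
  have h1 : 0 ≤ deriv ⇑(e ^ n) x := (strictMono_zpow hm n).monotone.deriv_nonneg
  have h2 : ContDiff ℝ ∞ (e ^ n).symm := by
    have : (e ^ n).symm = e ^ (-n) := by rw [zpow_neg]; rfl
    rw [this]
    exact contDiff_zpow he he' _
  exact lt_of_le_of_ne h1 (deriv_perm_ne_zero (contDiff_zpow he he' n) h2 x).symm

theorem strictMono_of_lt {e : Equiv.Perm ℝ} (hc : Continuous e) (hlt : ∀ x, x < e x) :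
    StrictMono e := by
  rcases hc.strictMono_of_inj e.injective with h | h
  · exact h
  · exact absurd (h (hlt 0)) (hlt (e 0)).le.not_gt

theorem zpow_add_one_apply (e : Equiv.Perm ℝ) (n : ℤ) (x : ℝ) :
    (e ^ (n + 1)) x = e ((e ^ n) x) := by
  rw [add_comm, zpow_add, zpow_one]
  rfl

/-- If the orbit were bounded with supremum `s`, then `e⁻¹ s < s` would lie below some orbit point,
whose successor would exceed `s`. -/
theorem exists_lt_zpow {e : Equiv.Perm ℝ} (hm : StrictMono e) (hlt : ∀ x, x < e x) (B : ℝ) :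
    ∃ n : ℤ, B < (e ^ n) 0 := by
  by_contra! h
  have hb : BddAbove (Set.range fun n : ℤ => (e ^ n) 0) := ⟨B, by rintro _ ⟨n, rfl⟩; exact h n⟩
  set s := sSup (Set.range fun n : ℤ => (e ^ n) 0) with hs
  have h1 : e.symm s < s := by simpa using hlt (e.symm s)
  obtain ⟨_, ⟨n, rfl⟩, hn⟩ := exists_lt_of_lt_csSup (Set.range_nonempty _) h1
  have h2 : s < e ((e ^ n) 0) := by simpa using hm hn
  rw [← zpow_add_one_apply] at h2
  exact (le_csSup hb ⟨n + 1, rfl⟩).not_gt h2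

theorem exists_zpow_lt {e : Equiv.Perm ℝ} (hm : StrictMono e) (hlt : ∀ x, x < e x) (B : ℝ) :
    ∃ n : ℤ, (e ^ n) 0 < B := by
  by_contra! h
  have hb : BddBelow (Set.range fun n : ℤ => (e ^ n) 0) := ⟨B, by rintro _ ⟨n, rfl⟩; exact h n⟩
  set s := sInf (Set.range fun n : ℤ => (e ^ n) 0) with hs
  obtain ⟨_, ⟨n, rfl⟩, hn⟩ := exists_lt_of_csInf_lt (Set.range_nonempty _) (hlt s)
  have h2 : (e ^ (n - 1)) 0 < s := by
    have h3 : (e ^ n) 0 = e ((e ^ (n - 1)) 0) := by rw [← zpow_add_one_apply, sub_add_cancel]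
    dsimp only at hn
    rw [h3] at hn
    exact hm.lt_iff_lt.1 hn
  exact (csInf_le hb ⟨n - 1, rfl⟩).not_gt h2

theorem strictMono_zpow_zero {e : Equiv.Perm ℝ} (hlt : ∀ x, x < e x) :
    StrictMono fun n : ℤ => (e ^ n) 0 :=
  strictMono_int_of_lt_succ fun n => by
    rw [zpow_add_one_apply]
    exact hlt _

theorem zpow_apply_zpow (e : Equiv.Perm ℝ) (n k : ℤ) (x : ℝ) :
    (e ^ n) ((e ^ k) x) = (e ^ (n + k)) x := by
  rw [zpow_add]
  rfl

theorem exists_zpow_mem_Icc {e : Equiv.Perm ℝ} (hm : StrictMono e) (hlt : ∀ x, x < e x) (x : ℝ) :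
    ∃ n : ℤ, (e ^ n) x ∈ Set.Icc 0 (e 0) := by
  obtain ⟨B, hB⟩ := exists_lt_zpow hm hlt x
  obtain ⟨A, hA⟩ := exists_zpow_lt hm hlt x
  obtain ⟨k, hk, hmax⟩ := Int.exists_greatest_of_bdd (P := fun k : ℤ => (e ^ k) 0 ≤ x)
    ⟨B, fun z hz => (((strictMono_zpow_zero hlt).lt_iff_lt).1 (lt_of_le_of_lt hz hB)).le⟩
    ⟨A, hA.le⟩
  have hk1 : x < (e ^ (k + 1)) 0 := by
    by_contra! h
    have := hmax _ h
    omega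
  refine ⟨-k, ?_, ?_⟩
  · have := (strictMono_zpow hm (-k)).monotone hk
    rwa [zpow_apply_zpow, neg_add_cancel] at this
  · have := (strictMono_zpow hm (-k)).monotone hk1.le
    rwa [zpow_apply_zpow, neg_add_cancel_left, zpow_one] at this

/-- The terms of the density of an Abel function. -/
noncomputable def abelTerm (e : Equiv.Perm ℝ) (b : ℝ → ℝ) (n : ℤ) (x : ℝ) : ℝ :=
  b ((e ^ n) x) * deriv ⇑(e ^ n) x

/-- Orbit points of `0` enclose both a neighbourhood of `x` and the support of `b`. By monotonicity,
`eⁿ` can bring the first to meet the second only for `n` in a bounded range. -/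
theorem locallyFinite_abelTerm {e : Equiv.Perm ℝ} (hm : StrictMono e) (hlt : ∀ x, x < e x)
    {b : ℝ → ℝ} (hb : HasCompactSupport b) :
    LocallyFinite fun n => Function.support (abelTerm e b n) := by
  obtain ⟨r, hr⟩ := exists_nat_support_subset hb
  obtain ⟨p, hp⟩ := exists_lt_zpow hm hlt r
  obtain ⟨q, hq⟩ := exists_zpow_lt hm hlt (-r)
  intro x
  obtain ⟨B, hB⟩ := exists_lt_zpow hm hlt x
  obtain ⟨A, hA⟩ := exists_zpow_lt hm hlt x
  refine ⟨Set.Ioo ((e ^ A) 0) ((e ^ B) 0), Ioo_mem_nhds hA hB,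
    (Set.finite_Icc (q - B) (p - A)).subset ?_⟩
  rintro n ⟨y, hy, hyA, hyB⟩
  have hne : b ((e ^ n) y) ≠ 0 := left_ne_zero_of_mul hy
  have habs : |(e ^ n) y| < r := by
    by_contra! h
    exact hne (hr _ h)
  have h1 := strictMono_zpow hm n hyA
  have h2 := strictMono_zpow hm n hyB
  rw [zpow_apply_zpow] at h1 h2
  rw [abs_lt] at habs
  have h3 := (strictMono_zpow_zero hlt).lt_iff_lt.1 (h1.trans (habs.2.trans hp))
  have h4 := (strictMono_zpow_zero hlt).lt_iff_lt.1 (hq.trans (habs.1.trans h2))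
  exact ⟨by omega, by omega⟩

/-- An invariant density: a positive smooth function `h` with `(h ∘ e) e' = h`. -/
theorem exists_invariant_density {e : Equiv.Perm ℝ} (he : ContDiff ℝ ∞ e)
    (he' : ContDiff ℝ ∞ e.symm) (hlt : ∀ x, x < e x) :
    ∃ h : ℝ → ℝ, ContDiff ℝ ∞ h ∧ (∀ x, 0 < h x) ∧ ∀ x, h (e x) * deriv e x = h x := by
  have hm := strictMono_of_lt he.continuous hlt
  -- The bump equals `1` on `[0, e 0]`, which every orbit meets, so some term of the sum is positive
  -- at each point.
  let b : ContDiffBump (0 : ℝ) := ⟨e 0, e 0 + 1, hlt 0, by linarith⟩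
  have hlf := locallyFinite_abelTerm hm hlt b.hasCompactSupport
  refine ⟨fun x => ∑ᶠ n, abelTerm e b n x, ?_, fun x => ?_, fun x => ?_⟩
  · refine ContMDiff.contDiff (contMDiff_finsum (fun n => ContDiff.contMDiff ?_) hlf)
    have h1 := contDiff_zpow he he' n
    exact (b.contDiff.comp h1).mul (contDiff_infty_iff_deriv.1 h1).2
  · obtain ⟨n, hn⟩ := exists_zpow_mem_Icc hm hlt x
    have h0 : ∀ k, 0 ≤ abelTerm e b k x := fun k =>
      mul_nonneg b.nonneg (deriv_zpow_pos he he' hm k x).le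
    have h1 : 0 < abelTerm e b n x := by
      have hb1 : b ((e ^ n) x) = 1 := by
        refine b.one_of_mem_closedBall ?_
        rw [mem_closedBall_zero_iff, Real.norm_eq_abs, abs_of_nonneg hn.1]
        exact hn.2
      rw [abelTerm, hb1, one_mul]
      exact deriv_zpow_pos he he' hm n x
    exact finsum_pos h0 ⟨n, h1⟩ (hlf.point_finite x)
  · dsimp only
    rw [finsum_mul,
      -- By the chain rule, passing from `x` to `e x` and multiplying by `e'` shifts the summation
      -- index by one.
      ← finsum_comp_equiv (Equiv.addRight (1 : ℤ)) (f := fun n => abelTerm e b n x)]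
    refine finsum_congr fun n => ?_
    have h1 := ((contDiff_zpow he he' n).differentiable (by simp) (e x)).hasDerivAt.comp x
      (he.differentiable (by simp) x).hasDerivAt
    have h2 : ⇑(e ^ (n + 1)) = ⇑(e ^ n) ∘ ⇑e := by rw [zpow_add_one]; rfl
    rw [Equiv.coe_addRight, abelTerm, abelTerm, h2, h1.deriv, mul_assoc]
    rfl

/-- Let `H` be the primitive of the invariant density. Invariance gives `H ∘ e - H` derivative zero,
and division by the integral over `[0, e 0]` makes this constant `1`. Since `H` takes the value `n`
at `eⁿ 0`, it is onto. -/
theorem exists_abel_of_lt {e : Equiv.Perm ℝ} (he : ContDiff ℝ ∞ e)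
    (he' : ContDiff ℝ ∞ e.symm) (hlt : ∀ x, x < e x) :
    ∃ H : ℝ ≃ₜ ℝ, ContDiff ℝ ∞ H ∧ ContDiff ℝ ∞ H.symm ∧ ∀ x, H (e x) = H x + 1 := by
  obtain ⟨h, hc, hpos, hinv⟩ := exists_invariant_density he he' hlt
  have hm := strictMono_of_lt he.continuous hlt
  set c := ∫ t in (0 : ℝ)..(e 0), h t with hcdef
  have hc0 : 0 < c := intervalIntegral.intervalIntegral_pos_of_pos
    (hc.continuous.intervalIntegrable _ _) hpos (hlt 0)
  set H : ℝ → ℝ := fun x => c⁻¹ * ∫ t in (0 : ℝ)..x, h t with hH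
  have hd : ∀ x, HasDerivAt H (c⁻¹ * h x) x := fun x =>
    (hc.continuous.integral_hasStrictDerivAt 0 x).hasDerivAt.const_mul _
  have hderiv : deriv H = fun x => c⁻¹ * h x := funext fun x => (hd x).deriv
  have hHc : ContDiff ℝ ∞ H := contDiff_infty_iff_deriv.2
    ⟨fun x => (hd x).differentiableAt, by rw [hderiv]; exact contDiff_const.mul hc⟩
  have hHm : StrictMono H := strictMono_of_deriv_pos fun x => by
    rw [hderiv]
    exact mul_pos (inv_pos.2 hc0) (hpos x)
  have habel : ∀ x, H (e x) = H x + 1 := by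
    have h1 : ∀ x, HasDerivAt (fun x => H (e x) - H x) 0 x := fun x => by
      have := ((hd (e x)).comp x (he.differentiable (by simp) x).hasDerivAt).sub (hd x)
      rwa [mul_assoc, hinv, sub_self] at this
    intro x
    have h2 := is_const_of_deriv_eq_zero (fun x => (h1 x).differentiableAt)
      (fun x => (h1 x).deriv) x 0
    have h3 : H (e 0) = 1 := by
      simp only [hH]
      exact inv_mul_cancel₀ hc0.ne'
    have h4 : H 0 = 0 := by simp [hH]
    linarith
  have hz : ∀ n : ℤ, H ((e ^ n) 0) = n := by
    have h0 : H 0 = 0 := by simp [hH]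
    intro n
    induction n using Int.induction_on with
    | zero => simpa using h0
    | succ n ih => rw [zpow_add_one_apply, habel, ih]; push_cast; ring
    | pred n ih =>
      have := habel ((e ^ (-(n : ℤ) - 1)) 0)
      rw [← zpow_add_one_apply, sub_add_cancel, ih] at this
      push_cast at this ⊢
      linarith
  have hsurj : Function.Surjective H := by
    refine hHc.continuous.surjective
      (tendsto_atTop_atTop_of_monotone hHm.monotone fun B => ?_)
      (tendsto_atBot_atBot_of_monotone hHm.monotone fun B => ?_)
    · obtain ⟨n, hn⟩ := exists_int_gt B
      exact ⟨(e ^ n) 0, by rw [hz]; exact hn.le⟩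
    · obtain ⟨n, hn⟩ := exists_int_lt B
      exact ⟨(e ^ n) 0, by rw [hz]; exact hn.le⟩
  let Φ : ℝ ≃ₜ ℝ := (hHm.orderIsoOfSurjective H hsurj).toHomeomorph
  have hΦ : ⇑Φ = H := rfl
  refine ⟨Φ, hHc, Φ.contDiff_symm_deriv (f' := fun x => c⁻¹ * h x)
    (fun x => (mul_pos (inv_pos.2 hc0) (hpos x)).ne') hd hHc, habel⟩

theorem exists_abel {e : Equiv.Perm ℝ} (he : ContDiff ℝ ∞ e) (he' : ContDiff ℝ ∞ e.symm)
    (hne : ∀ x, e x ≠ x) :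
    ∃ H : ℝ ≃ₜ ℝ, ContDiff ℝ ∞ H ∧ ContDiff ℝ ∞ H.symm ∧ ∀ x, H (e x) = H x + 1 := by
  have hdich : (∀ x, x < e x) ∨ ∀ x, e x < x := by
    by_contra! h
    obtain ⟨⟨x, hx⟩, y, hy⟩ := h
    obtain ⟨z, hz⟩ := mem_range_of_exists_le_of_exists_ge (c := (0 : ℝ))
      (f := fun x => e x - x) (he.continuous.sub continuous_id)
      ⟨x, sub_nonpos.2 hx⟩ ⟨y, sub_nonneg.2 hy⟩
    exact hne z (sub_eq_zero.1 hz)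
  rcases hdich with h | h
  · exact exists_abel_of_lt he he' h
  · obtain ⟨H, hH, hH', habel⟩ := exists_abel_of_lt (e := e.symm) he' he
      fun x => by simpa using h (e.symm x)
    refine ⟨H.trans (Homeomorph.neg ℝ), hH.neg, hH'.comp contDiff_neg, fun x => ?_⟩
    have := habel (e x)
    rw [Equiv.symm_apply_apply] at this
    change -H (e x) = -H x + 1
    linarith

end Abel

/-! ### Continuous seminorms built from weighted jets. -/

section Jets

variable {𝕜 : Type*} [RCLike 𝕜]

/-- The supremum of the weighted jets is finite and continuous on every step because the weights `c
i` beat each power of `1 + |x i|²`; that is all the inductive limit topology asks of a seminorm. -/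
theorem exists_indSeminorm {ι : Type*} (m : ℕ) (x c : ι → ℝ) (hc0 : ∀ i, 0 ≤ c i)
    (hc : ∀ n : ℕ, ∃ C, ∀ i, c i * (1 + |x i| ^ 2) ^ n ≤ C) :
    ∃ p : IndSeminorm 𝕜 m, ∀ f : Om 𝕜 m, ∀ i, ∀ j ≤ m,
      c i * ‖iteratedDeriv j (f : ℝ → 𝕜) (x i)‖ ≤ p.1 f := by
  let P : (ℝ → 𝕜) → ι × Fin (m + 1) → ℝ := fun f q =>
    c q.1 * ‖iteratedDeriv (q.2 : ℕ) f (x q.1)‖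
  have hP0 : ∀ f q, 0 ≤ P f q := fun f q => mul_nonneg (hc0 _) (norm_nonneg _)
  have hb : ∀ n : ℕ, ∃ C, ∀ f ∈ Omn 𝕜 m n, ∀ q, P f q ≤ C * omnNorm m n f := fun n => by
    obtain ⟨C, hC⟩ := hc n
    refine ⟨C, fun f hf q => ?_⟩
    have h1 := le_omnNorm hf.2 (Nat.le_of_lt_succ q.2.2) (x q.1)
    calc P f q ≤ c q.1 * (omnNorm m n f * (1 + |x q.1| ^ 2) ^ n) :=
          mul_le_mul_of_nonneg_left h1 (hc0 _)
      _ = (c q.1 * (1 + |x q.1| ^ 2) ^ n) * omnNorm m n f := by ring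
      _ ≤ C * omnNorm m n f := mul_le_mul_of_nonneg_right (hC _) (omnNorm_nonneg _ _ _)
  have hbdd : ∀ f : Om 𝕜 m, BddAbove (Set.range (P (f : ℝ → 𝕜))) := fun f => by
    obtain ⟨n, hn⟩ := mem_Om.1 f.2
    obtain ⟨C, hC⟩ := hb n
    exact ⟨_, by rintro _ ⟨q, rfl⟩; exact hC f hn q⟩
  have hcd : ∀ f : Om 𝕜 m, ContDiff ℝ m (f : ℝ → 𝕜) := fun f => by
    obtain ⟨n, hn⟩ := mem_Om.1 f.2
    exact hn.1
  have hsup0 : ∀ f : Om 𝕜 m, 0 ≤ ⨆ q, P (f : ℝ → 𝕜) q := fun f => Real.iSup_nonneg (hP0 _)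
  let p : Seminorm 𝕜 (Om 𝕜 m) := Seminorm.ofSMulLE (fun f => ⨆ q, P (f : ℝ → 𝕜) q)
    (by
      have : P ((0 : Om 𝕜 m) : ℝ → 𝕜) = fun _ => 0 := funext fun q => by simp [P]
      rw [this, Real.iSup_const_zero])
    (fun f g => by
      refine Real.iSup_le (fun q => ?_) (add_nonneg (hsup0 f) (hsup0 g))
      refine le_trans ?_ (add_le_add (le_ciSup (hbdd f) q) (le_ciSup (hbdd g) q))
      have hq : ((q.2 : ℕ) : WithTop ℕ∞) ≤ m := by exact_mod_cast Nat.le_of_lt_succ q.2.2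
      change c q.1 * ‖iteratedDeriv (q.2 : ℕ) ((f : ℝ → 𝕜) + (g : ℝ → 𝕜)) (x q.1)‖ ≤ _
      rw [iteratedDeriv_add ((hcd f).contDiffAt.of_le hq) ((hcd g).contDiffAt.of_le hq), ← mul_add]
      exact mul_le_mul_of_nonneg_left (norm_add_le _ _) (hc0 _))
    (fun a f => by
      refine Real.iSup_le (fun q => ?_) (mul_nonneg (norm_nonneg _) (hsup0 f))
      refine le_trans ?_ (mul_le_mul_of_nonneg_left (le_ciSup (hbdd f) q) (norm_nonneg a))
      change c q.1 * ‖iteratedDeriv (q.2 : ℕ) (a • (f : ℝ → 𝕜)) (x q.1)‖ ≤ _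
      rw [iteratedDeriv_const_smul_field, norm_smul]
      exact le_of_eq (by ring))
  refine ⟨⟨p, fun n => ?_⟩, fun f i j hj => ?_⟩
  · obtain ⟨C, hC⟩ := hb n
    refine ⟨|C|, fun f hf => Real.iSup_le (fun q => (hC f hf q).trans ?_)
      (mul_nonneg (abs_nonneg _) (omnNorm_nonneg _ _ _))⟩
    exact mul_le_mul_of_nonneg_right (le_abs_self C) (omnNorm_nonneg _ _ _)
  · exact le_ciSup (hbdd f) (i, ⟨j, Nat.lt_succ_of_le hj⟩)

/-- Neighbourhoods in `𝒪_M(ℝ)` on which weighted jets stay close to those of `f₀`. -/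
theorem exists_isOpen_jet_lt {ι : Type*} (m : ℕ) (x c : ι → ℝ) (hc0 : ∀ i, 0 ≤ c i)
    (hc : ∀ n : ℕ, ∃ C, ∀ i, c i * (1 + |x i| ^ 2) ^ n ≤ C) (f₀ : OMSpace 𝕜) {r : ℝ}
    (hr : 0 < r) :
    ∃ U : Set (OMSpace 𝕜), IsOpen U ∧ f₀ ∈ U ∧ ∀ f ∈ U, ∀ i, ∀ j ≤ m,
      c i * ‖iteratedDeriv j f.toFun (x i) - iteratedDeriv j f₀.toFun (x i)‖ < r := by
  obtain ⟨p, hp⟩ := exists_indSeminorm (𝕜 := 𝕜) m x c hc0 hc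
  refine ⟨_, isOpen_seminorm_ball p f₀ r, ?_, fun f hf i j hj => ?_⟩
  · simpa using hr
  · have h := hp (toOm 𝕜 m (f - f₀)) i j hj
    have e : ((toOm 𝕜 m (f - f₀) : Om 𝕜 m) : ℝ → 𝕜) = f.toFun - f₀.toFun := rfl
    rw [e, iteratedDeriv_sub (f.contDiff.contDiffAt.of_le (by exact_mod_cast le_top))
      (f₀.contDiff.contDiffAt.of_le (by exact_mod_cast le_top))] at h
    exact h.trans_lt hf

theorem exists_weight_bound_of_isCompact {K : Set ℝ} (hK : IsCompact K) (n : ℕ) :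
    ∃ C, ∀ y : K, (fun _ => (1 : ℝ)) y * (1 + |(y : ℝ)| ^ 2) ^ n ≤ C := by
  obtain ⟨C, hC⟩ := hK.exists_bound_of_continuousOn (f := fun y : ℝ => (1 + |y| ^ 2) ^ n)
    (by fun_prop)
  exact ⟨C, fun y => by simpa using (le_abs_self _).trans (hC y y.2)⟩

/-- For `k ≥ n` the product is at most `1`, and only finitely many `k` remain; nothing is needed of
the sequence `x`. -/
theorem exists_weight_bound_seq (x : ℕ → ℝ) (n : ℕ) :
    ∃ C, ∀ k : ℕ, ((1 + |x k| ^ 2) ^ k)⁻¹ * (1 + |x k| ^ 2) ^ n ≤ C := by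
  refine ⟨1 + ∑ k ∈ Finset.range n, (1 + |x k| ^ 2) ^ n, fun k => ?_⟩
  have hs : 0 ≤ ∑ k ∈ Finset.range n, (1 + |x k| ^ 2) ^ n :=
    Finset.sum_nonneg fun _ _ => by positivity
  rcases lt_or_ge k n with h | h
  · have h1 := Finset.single_le_sum (f := fun k => (1 + |x k| ^ 2) ^ n)
      (fun i _ => by positivity) (Finset.mem_range.2 h)
    have h2 : ((1 + |x k| ^ 2) ^ k)⁻¹ * (1 + |x k| ^ 2) ^ n ≤ (1 + |x k| ^ 2) ^ n :=
      mul_le_of_le_one_left (by positivity)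
        (inv_le_one_of_one_le₀ (one_le_pow₀ (one_le_weight _)))
    linarith
  · rw [inv_mul_le_iff₀ (by positivity)]
    have h1 : (1 + |x k| ^ 2) ^ n ≤ (1 + |x k| ^ 2) ^ k :=
      pow_le_pow_right₀ (one_le_weight _) h
    have h2 : 0 ≤ (1 + |x k| ^ 2) ^ k := by positivity
    nlinarith

theorem contDiff_ofReal (𝕜 : Type*) [RCLike 𝕜] : ContDiff ℝ ∞ (fun x : ℝ => (x : 𝕜)) :=
  (RCLike.ofRealCLM (K := 𝕜)).contDiff

theorem deriv_ofReal (𝕜 : Type*) [RCLike 𝕜] : deriv (fun x : ℝ => (x : 𝕜)) = fun _ => 1 := by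
  funext x
  simpa using (RCLike.ofRealCLM (K := 𝕜)).hasDerivAt (x := x) |>.deriv

theorem iteratedDeriv_ofReal_succ (𝕜 : Type*) [RCLike 𝕜] (j : ℕ) (x : ℝ) :
    iteratedDeriv (j + 1) (fun x : ℝ => (x : 𝕜)) x = if j = 0 then 1 else 0 := by
  rw [iteratedDeriv_succ', deriv_ofReal, iteratedDeriv_const]

theorem ofReal_mem_OM (𝕜 : Type*) [RCLike 𝕜] : (fun x : ℝ => (x : 𝕜)) ∈ OM 𝕜 := by
  refine mem_OM_of_bounds (contDiff_ofReal 𝕜) fun j => ⟨1, 1, fun x => ?_⟩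
  have hx := one_le_weight x
  rw [one_mul, pow_one]
  rcases j with _ | j
  · simp only [iteratedDeriv_zero, RCLike.norm_ofReal]
    nlinarith [sq_nonneg (|x| - 1), abs_nonneg x]
  · rw [iteratedDeriv_ofReal_succ]
    split_ifs
    · rwa [norm_one]
    · rw [norm_zero]
      linarith

theorem one_mem_OM (𝕜 : Type*) [RCLike 𝕜] : (fun _ : ℝ => (1 : 𝕜)) ∈ OM 𝕜 := by
  refine mem_OM_of_bounds contDiff_const fun j => ⟨0, 1, fun x => ?_⟩
  rw [iteratedDeriv_const]
  split_ifs <;> simp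

theorem iteratedDeriv_re {F : ℝ → 𝕜} (hF : ContDiff ℝ ∞ F) (j : ℕ) :
    iteratedDeriv j (fun x => RCLike.re (F x)) = fun x => RCLike.re (iteratedDeriv j F x) := by
  induction j with
  | zero => simp
  | succ j ih =>
    rw [iteratedDeriv_succ, ih]
    funext x
    have h1 := ((contDiff_iteratedDeriv hF j).differentiable (by simp) x).hasDerivAt
    rw [iteratedDeriv_succ]
    exact ((RCLike.reCLM (K := 𝕜)).hasFDerivAt.comp_hasDerivAt x h1).deriv

end Jets

/-! ### Solving `f = g ∘ u` for the derivatives of `u`. -/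

section InverseBounds

/-- If `f = g ∘ u` with `g'` bounded away from `0` at `u x`, then the derivatives of `u` at `x` are
bounded by a power of those of `f`. -/
theorem exists_deriv_bound_of_comp (m : ℕ) : ∃ (C : ℝ) (E : ℕ), 1 ≤ C ∧
    ∀ (f g u : ℝ → ℝ) (x D : ℝ), ContDiff ℝ ∞ g → ContDiff ℝ ∞ u → f = g ∘ u →
      1 ≤ D → 1 / 2 ≤ |deriv g (u x)| →
      (∀ i, 1 ≤ i → i ≤ m → |iteratedDeriv i g (u x)| ≤ 2) →
      (∀ i, 1 ≤ i → i ≤ m → |iteratedDeriv i f x| ≤ D) →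
      ∀ i, 1 ≤ i → i ≤ m → |iteratedDeriv i u x| ≤ C * D ^ E := by
  induction m with
  | zero => exact ⟨1, 0, le_rfl, fun _ _ _ _ _ _ _ _ _ _ _ _ i h1 h2 => by omega⟩
  | succ m ih =>
    obtain ⟨C, E, hC, h⟩ := ih
    -- The exponent `E * (m + 1)` comes from the power `m + 1` of the previous bound `C * D ^ E`,
    -- and the extra `1` accommodates `D` itself.
    refine ⟨C + (2 + 2 * (2 ^ m * (m.factorial * 2 * C ^ (m + 1)))), E * (m + 1) + 1, ?_, ?_⟩
    · have : 0 ≤ 2 + 2 * (2 ^ m * (m.factorial * 2 * C ^ (m + 1))) := by positivity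
      linarith
    intro f g u x D hg hu hf hD hg1 hg2 hf2 i hi1 him
    have hQ := h f g u x D hg hu hf hD hg1 (fun i h1 h2 => hg2 i h1 (by omega))
      (fun i h1 h2 => hf2 i h1 (by omega))
    set Q := C * D ^ E with hQdef
    have hQ1 : 1 ≤ Q := one_le_mul_of_one_le_of_one_le hC (one_le_pow₀ hD)
    have hrest : 0 ≤ 2 + 2 * (2 ^ m * (m.factorial * 2 * C ^ (m + 1))) := by positivity
    rcases Nat.lt_or_ge i (m + 1) with hlt | hge
    · refine (hQ i hi1 (by omega)).trans ?_
      refine mul_le_mul (by linarith) (pow_le_pow_right₀ hD ?_) (by positivity) (by linarith)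
      nlinarith
    obtain rfl : i = m + 1 := le_antisymm him hge
    have hg' : ContDiff ℝ ∞ (deriv g) := (contDiff_infty_iff_deriv.1 hg).2
    have hu' : ContDiff ℝ ∞ (deriv u) := (contDiff_infty_iff_deriv.1 hu).2
    have hderiv : deriv f = (deriv g ∘ u) * deriv u := by
      funext y
      rw [hf]
      exact ((hg.differentiable (by simp) (u y)).hasDerivAt.comp y
        (hu.differentiable (by simp) y).hasDerivAt).deriv
    -- Leibniz's rule for `f' = (g' ∘ u) u'` with the top-order term split off: the remaining sum
    -- involves derivatives of `u` of order at most `m` only, and the coefficient `g'(u x)` can be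
    -- divided out.
    have hexp : iteratedDeriv (m + 1) f x = ∑ i ∈ Finset.range m,
        ((m.choose (i + 1) : ℝ) * iteratedDeriv (i + 1) (deriv g ∘ u) x *
          iteratedDeriv (m - (i + 1)) (deriv u) x) +
        deriv g (u x) * iteratedDeriv (m + 1) u x := by
      rw [iteratedDeriv_succ', hderiv, iteratedDeriv_mul
        ((hg'.comp hu).contDiffAt.of_le (by exact_mod_cast le_top))
        (hu'.contDiffAt.of_le (by exact_mod_cast le_top)), Finset.sum_range_succ']
      simp [iteratedDeriv_succ']
    have hterm : ∀ i ∈ Finset.range m, |(m.choose (i + 1) : ℝ) *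
        iteratedDeriv (i + 1) (deriv g ∘ u) x * iteratedDeriv (m - (i + 1)) (deriv u) x| ≤
        (m.choose (i + 1) : ℝ) * (m.factorial * 2 * Q ^ (m + 1)) := by
      intro i hi
      have hi' := Finset.mem_range.1 hi
      have h1 := norm_iteratedFDeriv_comp_le (𝕜 := ℝ) (g := deriv g) (f := u) (n := i + 1) hg' hu
        (by exact_mod_cast le_top) x (C := 2) (D := Q)
        (fun k hk => by
          rw [norm_iteratedFDeriv_eq_norm_iteratedDeriv, ← iteratedDeriv_succ', Real.norm_eq_abs]
          exact hg2 _ (by omega) (by omega))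
        (fun k hk1 hk => by
          rw [norm_iteratedFDeriv_eq_norm_iteratedDeriv, Real.norm_eq_abs]
          exact (hQ k hk1 (by omega)).trans (le_self_pow₀ hQ1 (by omega)))
      rw [norm_iteratedFDeriv_eq_norm_iteratedDeriv, Real.norm_eq_abs] at h1
      have h2 : |iteratedDeriv (m - (i + 1)) (deriv u) x| ≤ Q := by
        rw [← iteratedDeriv_succ']
        exact hQ _ (by omega) (by omega)
      rw [abs_mul, abs_mul, Nat.abs_cast, mul_assoc]
      refine mul_le_mul_of_nonneg_left ?_ (Nat.cast_nonneg _)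
      have h3 : ((i + 1).factorial : ℝ) ≤ m.factorial := by
        exact_mod_cast Nat.factorial_le (by omega)
      calc _ ≤ ((i + 1).factorial * 2 * Q ^ (i + 1)) * Q :=
            mul_le_mul h1 h2 (abs_nonneg _) (by positivity)
        _ = (i + 1).factorial * 2 * Q ^ (i + 2) := by ring
        _ ≤ m.factorial * 2 * Q ^ (m + 1) := by
            exact mul_le_mul (by gcongr) (pow_le_pow_right₀ hQ1 (by omega)) (by positivity)
              (by positivity)
    have hsum : |∑ i ∈ Finset.range m, ((m.choose (i + 1) : ℝ) *
        iteratedDeriv (i + 1) (deriv g ∘ u) x * iteratedDeriv (m - (i + 1)) (deriv u) x)| ≤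
        2 ^ m * (m.factorial * 2 * Q ^ (m + 1)) := by
      refine (Finset.abs_sum_le_sum_abs _ _).trans ((Finset.sum_le_sum hterm).trans ?_)
      rw [← Finset.sum_mul]
      gcongr
      have h1 : ∑ i ∈ Finset.range (m + 1), m.choose i = 2 ^ m := Nat.sum_range_choose m
      rw [Finset.sum_range_succ'] at h1
      have h2 : ∑ i ∈ Finset.range m, m.choose (i + 1) ≤ 2 ^ m := by omega
      exact_mod_cast h2
    have hmain : |deriv g (u x) * iteratedDeriv (m + 1) u x| ≤
        D + 2 ^ m * (m.factorial * 2 * Q ^ (m + 1)) := by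
      have e : deriv g (u x) * iteratedDeriv (m + 1) u x = iteratedDeriv (m + 1) f x -
        ∑ i ∈ Finset.range m, ((m.choose (i + 1) : ℝ) *
          iteratedDeriv (i + 1) (deriv g ∘ u) x * iteratedDeriv (m - (i + 1)) (deriv u) x) := by
        rw [hexp]; ring
      rw [e]
      exact (abs_sub _ _).trans (add_le_add (hf2 _ (by omega) le_rfl) hsum)
    rw [abs_mul] at hmain
    have h5 : |iteratedDeriv (m + 1) u x| ≤
        2 * D + 2 * (2 ^ m * (m.factorial * 2 * Q ^ (m + 1))) := by
      have := mul_le_mul_of_nonneg_right hg1 (abs_nonneg (iteratedDeriv (m + 1) u x))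
      linarith
    have hDE : D ≤ D ^ (E * (m + 1) + 1) := le_self_pow₀ hD (by omega)
    have hQE : Q ^ (m + 1) ≤ C ^ (m + 1) * D ^ (E * (m + 1) + 1) := by
      rw [hQdef, mul_pow, ← pow_mul]
      exact mul_le_mul_of_nonneg_left (pow_le_pow_right₀ hD (by omega)) (by positivity)
    have hpos : 0 ≤ D ^ (E * (m + 1) + 1) := by positivity
    calc _ ≤ 2 * D + 2 * (2 ^ m * (m.factorial * 2 * Q ^ (m + 1))) := h5
      _ ≤ 2 * D ^ (E * (m + 1) + 1) + 2 * (2 ^ m * (m.factorial * 2 *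
            (C ^ (m + 1) * D ^ (E * (m + 1) + 1)))) := by gcongr
      _ ≤ C * D ^ (E * (m + 1) + 1) + 2 * D ^ (E * (m + 1) + 1) + 2 * (2 ^ m * (m.factorial * 2 *
            (C ^ (m + 1) * D ^ (E * (m + 1) + 1)))) := by
          have : 0 ≤ C * D ^ (E * (m + 1) + 1) := by positivity
          linarith
      _ = _ := by ring

/-- Slow growth of the derivatives of a sequence `v n` of maps for which some functions close to the
identity on `K` can be transported by `v n` to functions that are small along any given sequence. -/
theorem exists_slow_growth_of_transport {v : ℕ → ℝ → ℝ} (hv : ∀ n, ContDiff ℝ ∞ (v n))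
    {K : Set ℝ} (m : ℕ)
    (h : ∀ x : ℕ → ℝ, ∃ N, ∀ n ≥ N, ∃ f g : ℝ → ℝ, ContDiff ℝ ∞ g ∧ f = g ∘ v n ∧
      (∀ k, ∀ j ≤ m, |iteratedDeriv j f (x k)| ≤ (1 + |x k| ^ 2) ^ k) ∧
      (∀ y ∈ K, 1 / 2 ≤ |deriv g y|) ∧
      ∀ y ∈ K, ∀ i, 1 ≤ i → i ≤ m → |iteratedDeriv i g y| ≤ 2) :
    ∃ (k : ℕ) (C : ℝ), ∀ n ≥ k, ∀ x, v n x ∈ K → ∀ i, 1 ≤ i → i ≤ m →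
      |iteratedDeriv i (v n) x| ≤ C * (1 + |x| ^ 2) ^ k := by
  obtain ⟨C, E, hC, hCE⟩ := exists_deriv_bound_of_comp m
  by_contra! hcon
  -- The exponent `k * E + k` is at least `k * E`, which the final bound needs, and at least `k`, so
  -- that `n N` reaches the threshold `N`. That threshold depends on the whole sequence `x`; the
  -- contradiction is read off at its index `N`.
  choose n hn x hx i hi1 hi2 hi using fun k => hcon (k * E + k) C
  obtain ⟨N, hN⟩ := h x
  obtain ⟨f, g, hg, hf, hsmall, hg1, hg2⟩ := hN (n N) (le_trans (by nlinarith) (hn N))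
  have hb := hCE f g (v (n N)) (x N) ((1 + |x N| ^ 2) ^ N) hg (hv _) hf
    (one_le_pow₀ (one_le_weight _)) (hg1 _ (hx N)) (hg2 _ (hx N))
    (fun i _ him => hsmall N i him) (i N) (hi1 N) (hi2 N)
  have h1 : C * ((1 + |x N| ^ 2) ^ N) ^ E ≤ C * (1 + |x N| ^ 2) ^ (N * E + N) := by
    rw [← pow_mul]
    exact le_weight_of_le le_rfl (by linarith) (by omega)
  linarith [hi N]

end InverseBounds

/-! ### Consequences of mixing for the symbol, and slow growth of the Abel function. -/

section Mixing

variable {𝕜 : Type*} [RCLike 𝕜]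

theorem exists_isOpen_small (m : ℕ) (x : ℕ → ℝ) :
    ∃ U : Set (OMSpace 𝕜), IsOpen U ∧ U.Nonempty ∧ ∀ f ∈ U, ∀ k, ∀ j ≤ m,
      |iteratedDeriv j (fun y => RCLike.re (f.toFun y)) (x k)| ≤ (1 + |x k| ^ 2) ^ k := by
  obtain ⟨U, hU, h0, h⟩ := exists_isOpen_jet_lt (𝕜 := 𝕜) m x (fun k => ((1 + |x k| ^ 2) ^ k)⁻¹)
    (fun k => by positivity) (exists_weight_bound_seq x) 0 one_pos
  refine ⟨U, hU, ⟨0, h0⟩, fun f hf k j hj => ?_⟩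
  have h1 := h f hf k j hj
  have e : (0 : OMSpace 𝕜).toFun = fun _ => 0 := rfl
  rw [e, iteratedDeriv_const, ite_self, sub_zero, inv_mul_lt_iff₀ (by positivity), mul_one] at h1
  rw [iteratedDeriv_re f.contDiff]
  exact (RCLike.abs_re_le_norm _).trans h1.le

/-- Derivatives of orders `1` to `m + 1` on `K` within `1/2` of those of the identity suffice. Real
parts are taken since the symbol is real while `f` is `𝕜`-valued. -/
theorem exists_isOpen_near_id (m : ℕ) {K : Set ℝ} (hK : IsCompact K) :
    ∃ U : Set (OMSpace 𝕜), IsOpen U ∧ U.Nonempty ∧ ∀ f ∈ U,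
      (∀ y ∈ K, 1 / 2 ≤ |deriv (fun y => RCLike.re (f.toFun y)) y|) ∧
      ∀ y ∈ K, ∀ i, 1 ≤ i → i ≤ m →
        |iteratedDeriv i (fun y => RCLike.re (f.toFun y)) y| ≤ 2 := by
  obtain ⟨U, hU, h0, h⟩ := exists_isOpen_jet_lt (𝕜 := 𝕜) (m + 1) (fun y : K => (y : ℝ))
    (fun _ => 1) (fun _ => zero_le_one) (exists_weight_bound_of_isCompact hK)
    (OMSpace.mk _ (ofReal_mem_OM 𝕜)) one_half_pos
  have key : ∀ f ∈ U, ∀ y ∈ K, ∀ i ≤ m,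
      |iteratedDeriv (i + 1) (fun y => RCLike.re (f.toFun y)) y - if i = 0 then 1 else 0|
        ≤ 1 / 2 := by
    intro f hf y hy i hi
    have h1 := h f hf ⟨y, hy⟩ (i + 1) (by omega)
    rw [one_mul, OMSpace.mk_toFun, iteratedDeriv_ofReal_succ] at h1
    rw [iteratedDeriv_re f.contDiff]
    have h2 := (RCLike.abs_re_le_norm _).trans h1.le
    have e : RCLike.re (if i = 0 then (1 : 𝕜) else 0) = if i = 0 then (1 : ℝ) else 0 := by
      split_ifs <;> simp
    rwa [map_sub, e] at h2
  refine ⟨U, hU, ⟨_, h0⟩, fun f hf => ⟨fun y hy => ?_, fun y hy i hi1 him => ?_⟩⟩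
  · have h1 := key f hf y hy 0 (Nat.zero_le _)
    rw [zero_add, iteratedDeriv_one, if_pos rfl, abs_le] at h1
    exact le_trans (by linarith) (le_abs_self _)
  · obtain ⟨i, rfl⟩ : ∃ k, i = k + 1 := ⟨i - 1, by omega⟩
    have h1 := key f hf y hy i (by omega)
    rw [abs_le] at h1 ⊢
    split_ifs at h1 <;> constructor <;> linarith

/-- At a fixed point all iterates `C_ψⁿ f` have the same value, which cannot be within `1/2` of both
`0` and `1`. -/
theorem ne_self_of_isMixing {ψ : ℝ → ℝ} {hψ : ψ ∈ OM ℝ} (hmix : IsMixing (compOp 𝕜 ψ hψ))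
    (x : ℝ) : ψ x ≠ x := by
  intro hx
  have hw : ∀ n : ℕ, ∃ C, ∀ _ : Unit, (1 : ℝ) * (1 + |x| ^ 2) ^ n ≤ C := fun n =>
    ⟨_, fun _ => le_rfl⟩
  obtain ⟨U, hU, hU0, h⟩ := exists_isOpen_jet_lt (𝕜 := 𝕜) 0 (fun _ : Unit => x)
    (fun _ => 1) (fun _ => zero_le_one) hw 0 one_half_pos
  obtain ⟨V, hV, hV0, h'⟩ := exists_isOpen_jet_lt (𝕜 := 𝕜) 0 (fun _ : Unit => x)
    (fun _ => 1) (fun _ => zero_le_one) hw (OMSpace.mk _ (one_mem_OM 𝕜)) one_half_pos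
  obtain ⟨N, hN⟩ := hmix U V hU hV ⟨_, hU0⟩ ⟨_, hV0⟩
  obtain ⟨_, ⟨f, hf, rfl⟩, hfV⟩ := hN N le_rfl
  have h1 := h f hf () 0 le_rfl
  have h2 := h' _ hfV () 0 le_rfl
  have e : (0 : OMSpace 𝕜).toFun = fun _ => 0 := rfl
  rw [compOp_iterate_toFun] at h2
  simp only [iteratedDeriv_zero, one_mul, e, sub_zero, OMSpace.mk_toFun, Function.comp_apply,
    Function.iterate_fixed hx] at h1 h2
  have h3 := norm_sub_norm_le (1 : 𝕜) (f.toFun x)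
  rw [norm_one, norm_sub_rev] at h3
  linarith

/-- At a critical point of `ψ` every `g ∘ ψ` has derivative zero, so no positive iterate of `C_ψ`
reaches functions close to the identity there. -/
theorem deriv_ne_zero_of_isMixing {ψ : ℝ → ℝ} {hψ : ψ ∈ OM ℝ}
    (hmix : IsMixing (compOp 𝕜 ψ hψ)) (x : ℝ) : deriv ψ x ≠ 0 := by
  intro hx
  obtain ⟨V, hV, hV0, h⟩ := exists_isOpen_near_id (𝕜 := 𝕜) 0 (isCompact_singleton (x := x))
  obtain ⟨N, hN⟩ := hmix Set.univ V isOpen_univ hV Set.univ_nonempty hV0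
  obtain ⟨_, ⟨f, -, rfl⟩, hfV⟩ := hN (N + 1) (Nat.le_succ N)
  have h1 := (h _ hfV).1 x rfl
  have hψc := contDiff_of_mem_OM hψ
  have hd : HasDerivAt ψ 0 x := hx ▸ (hψc.differentiable (by simp) x).hasDerivAt
  have hre : ContDiff ℝ ∞ fun y => RCLike.re (((compOp 𝕜 ψ hψ)^[N] f).toFun y) :=
    (RCLike.reCLM (K := 𝕜)).contDiff.comp (OMSpace.contDiff _)
  have h2 := (hre.differentiable (by simp) (ψ x)).hasDerivAt.comp x hd
  have e : (fun y => RCLike.re (((compOp 𝕜 ψ hψ)^[N + 1] f).toFun y)) =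
      (fun y => RCLike.re (((compOp 𝕜 ψ hψ)^[N] f).toFun y)) ∘ ψ := by
    rw [Function.iterate_succ_apply']
    rfl
  rw [e, h2.deriv] at h1
  norm_num at h1

theorem contDiff_symm_of_deriv_ne_zero {e : Equiv.Perm ℝ} (he : ContDiff ℝ ∞ e)
    (hd : ∀ x, deriv e x ≠ 0) : ContDiff ℝ ∞ e.symm := by
  have hopen : IsOpenMap e := isOpenMap_of_hasStrictDerivAt (f' := deriv e)
    (fun {x} => he.contDiffAt.hasStrictDerivAt (by simp)) (fun {x} => hd x)
  exact (e.toHomeomorphOfContinuousOpen he.continuous hopen).contDiff_symm_deriv (f' := deriv e) hd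
    (fun x => (he.differentiable (by simp) x).hasDerivAt) he

theorem natCast_zpow_eq_iterate (e : Equiv.Perm ℝ) (n : ℕ) : ⇑(e ^ (n : ℤ)) = e^[n] := by
  rw [zpow_natCast, Equiv.Perm.iterate_eq_pow]

/-- The backward iterates of the symbol of a mixing operator have slowly growing derivatives. -/
theorem exists_slow_growth_backward {e : Equiv.Perm ℝ} {he : ⇑e ∈ OM ℝ}
    (hmix : IsMixing (compOp 𝕜 e he)) {K : Set ℝ} (hK : IsCompact K) (m : ℕ) :
    ∃ (k : ℕ) (C : ℝ), ∀ n ≥ k, ∀ x, (e ^ (-(n : ℤ))) x ∈ K → ∀ i, 1 ≤ i → i ≤ m →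
      |iteratedDeriv i ⇑(e ^ (-(n : ℤ))) x| ≤ C * (1 + |x| ^ 2) ^ k := by
  have hc := contDiff_of_mem_OM he
  have hc' := contDiff_symm_of_deriv_ne_zero hc (deriv_ne_zero_of_isMixing hmix)
  refine exists_slow_growth_of_transport (fun n => contDiff_zpow hc hc' _) m fun x => ?_
  obtain ⟨U, hU, hU0, h⟩ := exists_isOpen_small (𝕜 := 𝕜) m x
  obtain ⟨V, hV, hV0, h'⟩ := exists_isOpen_near_id (𝕜 := 𝕜) m hK
  obtain ⟨N, hN⟩ := hmix U V hU hV hU0 hV0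
  refine ⟨N, fun n hn => ?_⟩
  obtain ⟨_, ⟨f, hf, rfl⟩, hfV⟩ := hN n hn
  -- Here the small function is `f` and the one close to the identity is `C_ψⁿ f`, so that `f =
  -- (C_ψⁿ f) ∘ ψ_{-n}`.
  refine ⟨fun y => RCLike.re (f.toFun y), fun y => RCLike.re (((compOp 𝕜 e he)^[n] f).toFun y),
    (RCLike.reCLM (K := 𝕜)).contDiff.comp (OMSpace.contDiff _), ?_, h f hf,
    (h' _ hfV).1, (h' _ hfV).2⟩
  funext y
  rw [Function.comp_apply, compOp_iterate_toFun, ← natCast_zpow_eq_iterate, Function.comp_apply,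
    zpow_apply_zpow, add_neg_cancel]
  rfl

/-- The forward iterates of the symbol of a mixing operator have slowly growing derivatives. -/
theorem exists_slow_growth_forward {e : Equiv.Perm ℝ} {he : ⇑e ∈ OM ℝ}
    (hmix : IsMixing (compOp 𝕜 e he)) {K : Set ℝ} (hK : IsCompact K) (m : ℕ) :
    ∃ (k : ℕ) (C : ℝ), ∀ n ≥ k, ∀ x, (e ^ (n : ℤ)) x ∈ K → ∀ i, 1 ≤ i → i ≤ m →
      |iteratedDeriv i ⇑(e ^ (n : ℤ)) x| ≤ C * (1 + |x| ^ 2) ^ k := by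
  have hc := contDiff_of_mem_OM he
  have hc' := contDiff_symm_of_deriv_ne_zero hc (deriv_ne_zero_of_isMixing hmix)
  refine exists_slow_growth_of_transport (fun n => contDiff_zpow hc hc' _) m fun x => ?_
  obtain ⟨U, hU, hU0, h⟩ := exists_isOpen_small (𝕜 := 𝕜) m x
  obtain ⟨V, hV, hV0, h'⟩ := exists_isOpen_near_id (𝕜 := 𝕜) m hK
  -- The open sets are exchanged: now `f` is close to the identity on `K` and `C_ψⁿ f = f ∘ ψ_n` is
  -- small along `x`.
  obtain ⟨N, hN⟩ := hmix V U hV hU hV0 hU0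
  refine ⟨N, fun n hn => ?_⟩
  obtain ⟨_, ⟨f, hf, rfl⟩, hfU⟩ := hN n hn
  refine ⟨fun y => RCLike.re (((compOp 𝕜 e he)^[n] f).toFun y), fun y => RCLike.re (f.toFun y),
    (RCLike.reCLM (K := 𝕜)).contDiff.comp (OMSpace.contDiff _), ?_, h _ hfU,
    (h' f hf).1, (h' f hf).2⟩
  funext y
  rw [Function.comp_apply, compOp_iterate_toFun, natCast_zpow_eq_iterate, Function.comp_apply]

theorem abel_zpow {e : Equiv.Perm ℝ} {H : ℝ → ℝ} (habel : ∀ x, H (e x) = H x + 1) (n : ℤ)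
    (x : ℝ) : H ((e ^ n) x) = H x + n := by
  induction n using Int.induction_on with
  | zero => simp
  | succ n ih => rw [zpow_add_one_apply, habel, ih]; push_cast; ring
  | pred n ih =>
    have := habel ((e ^ (-(n : ℤ) - 1)) x)
    rw [← zpow_add_one_apply, sub_add_cancel, ih] at this
    push_cast at this ⊢
    linarith

theorem exists_bound_iteratedDeriv_on_compact {f : ℝ → ℝ} (hf : ContDiff ℝ ∞ f) {K : Set ℝ}
    (hK : IsCompact K) (m : ℕ) : ∃ B : ℝ, 0 ≤ B ∧ ∀ i ≤ m, ∀ y ∈ K, |iteratedDeriv i f y| ≤ B := by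
  choose C hC using fun i => hK.exists_bound_of_continuousOn
    (continuous_iteratedDeriv_of_contDiff hf i).continuousOn
  refine ⟨∑ i ∈ Finset.range (m + 1), |C i|, Finset.sum_nonneg fun _ _ => abs_nonneg _,
    fun i hi y hy => (hC i y hy).trans ((le_abs_self _).trans ?_)⟩
  exact Finset.single_le_sum (f := fun i => |C i|) (fun _ _ => abs_nonneg _)
    (Finset.mem_range.2 (Nat.lt_succ_of_le hi))

/-- The derivatives of an Abel function, in terms of those of an iterate of the symbol. -/
theorem abs_iteratedDeriv_abel_le {e : Equiv.Perm ℝ} (he : ∀ n : ℤ, ContDiff ℝ ∞ ⇑(e ^ n))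
    {H : ℝ → ℝ} (hH : ContDiff ℝ ∞ H) (habel : ∀ x, H (e x) = H x + 1) {j : ℕ} (hj : 1 ≤ j)
    {B Q x : ℝ} (n : ℤ) (hB : ∀ i ≤ j, |iteratedDeriv i H ((e ^ n) x)| ≤ B) (hQ1 : 1 ≤ Q)
    (hQ : ∀ i, 1 ≤ i → i ≤ j → |iteratedDeriv i ⇑(e ^ n) x| ≤ Q) :
    |iteratedDeriv j H x| ≤ j.factorial * B * Q ^ j := by
  have h1 : H ∘ ⇑(e ^ n) = fun z => (n : ℝ) + H z := by
    funext z
    rw [Function.comp_apply, abel_zpow habel, add_comm]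
  have h2 := norm_iteratedFDeriv_comp_le (𝕜 := ℝ) (g := H) (f := ⇑(e ^ n)) (n := j) hH (he n)
    (by exact_mod_cast le_top) x (C := B) (D := Q)
    (fun i hi => by
      rw [norm_iteratedFDeriv_eq_norm_iteratedDeriv]
      exact hB i hi)
    (fun i hi1 hi => by
      rw [norm_iteratedFDeriv_eq_norm_iteratedDeriv]
      exact (hQ i hi1 hi).trans (le_self_pow₀ hQ1 (by omega)))
  rwa [norm_iteratedFDeriv_eq_norm_iteratedDeriv, h1, iteratedDeriv_const_add (by omega),
    Real.norm_eq_abs] at h2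

/-- The Abel functions of the symbol of a mixing composition operator grow slowly. -/
theorem abel_mem_OM {e : Equiv.Perm ℝ} {he : ⇑e ∈ OM ℝ} (hmix : IsMixing (compOp 𝕜 e he))
    {H : ℝ ≃ₜ ℝ} (hH : ContDiff ℝ ∞ H) (habel : ∀ x, H (e x) = H x + 1) : ⇑H ∈ OM ℝ := by
  have hc := contDiff_of_mem_OM he
  have hc' := contDiff_symm_of_deriv_ne_zero hc (deriv_ne_zero_of_isMixing hmix)
  have hpos : ∀ j, 1 ≤ j → ∃ (n : ℕ) (C : ℝ), ∀ x,
      ‖iteratedDeriv j H x‖ ≤ C * (1 + |x| ^ 2) ^ n := by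
    intro j hj
    have hcomp : ∀ a b, IsCompact (H ⁻¹' Set.Icc a b) := fun a b =>
      H.isCompact_preimage.2 isCompact_Icc
    obtain ⟨k₁, C₁, h₁⟩ := exists_slow_growth_backward hmix (hcomp 0 1) j
    obtain ⟨k₂, C₂, h₂⟩ := exists_slow_growth_forward hmix (hcomp 0 1) j
    obtain ⟨B, hB0, hB⟩ := exists_bound_iteratedDeriv_on_compact hH (hcomp 0 1) j
    obtain ⟨B', hB0', hB'⟩ := exists_bound_iteratedDeriv_on_compact hH
      (hcomp (-(k₂ : ℝ)) (k₁ + 1)) j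
    have hQ : ∀ (k : ℕ) (C : ℝ) (n : ℤ) (x : ℝ), (e ^ n) x ∈ H ⁻¹' Set.Icc 0 1 →
        (∀ i, 1 ≤ i → i ≤ j → |iteratedDeriv i ⇑(e ^ n) x| ≤ C * (1 + |x| ^ 2) ^ k) →
        |iteratedDeriv j H x| ≤ j.factorial * B * (1 + |C|) ^ j * (1 + |x| ^ 2) ^ (k * j) := by
      intro k C n x hx hd
      have hC1 : 1 ≤ 1 + |C| := le_add_of_nonneg_right (abs_nonneg C)
      have := abs_iteratedDeriv_abel_le (contDiff_zpow hc hc') hH habel hj n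
        (fun i hi => hB i hi _ hx) (Q := (1 + |C|) * (1 + |x| ^ 2) ^ k)
        (one_le_mul_of_one_le_of_one_le hC1 (one_le_pow₀ (one_le_weight x)))
        (fun i hi1 hi => (hd i hi1 hi).trans
          (le_weight_of_le (by linarith [le_abs_self C]) (by linarith) le_rfl))
      rwa [mul_pow, ← pow_mul, ← mul_assoc] at this
    refine ⟨k₁ * j + k₂ * j, B' + j.factorial * B * (1 + |C₁|) ^ j +
      j.factorial * B * (1 + |C₂|) ^ j, fun x => ?_⟩
    have hA₁ : 0 ≤ j.factorial * B * (1 + |C₁|) ^ j := by positivity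
    have hA₂ : 0 ≤ j.factorial * B * (1 + |C₂|) ^ j := by positivity
    have hfl := Int.floor_le (H x)
    have hfl' := Int.lt_floor_add_one (H x)
    -- The iterate bringing `x` into the fundamental domain; `H` takes it to the fractional part of
    -- `H x`.
    have hmem : ∀ n : ℤ, n = -⌊H x⌋ → (e ^ n) x ∈ H ⁻¹' Set.Icc 0 1 := by
      rintro n rfl
      rw [Set.mem_preimage, abel_zpow habel]
      push_cast
      exact ⟨by linarith, by linarith⟩
    rw [Real.norm_eq_abs]
    by_cases hn₁ : (k₁ : ℤ) ≤ ⌊H x⌋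
    · obtain ⟨n, hn⟩ := Int.eq_ofNat_of_zero_le ((Int.natCast_nonneg _).trans hn₁)
      have hx := hmem (-(n : ℤ)) (by rw [hn])
      refine (hQ k₁ C₁ _ x hx (h₁ n (by omega) x hx)).trans ?_
      exact le_weight_of_le (by linarith) (by linarith) (by omega)
    by_cases hn₂ : ⌊H x⌋ ≤ -(k₂ : ℤ)
    · obtain ⟨n, hn⟩ := Int.eq_ofNat_of_zero_le (a := -⌊H x⌋) (by omega)
      have hx := hmem (n : ℤ) (by rw [hn])
      refine (hQ k₂ C₂ _ x hx (h₂ n (by omega) x hx)).trans ?_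
      exact le_weight_of_le (by linarith) (by linarith) (by omega)
    -- For the finitely many remaining values of `⌊H x⌋` the point `x` itself stays in a compact
    -- set.
    · have h3 : (⌊H x⌋ : ℝ) ≤ k₁ := by exact_mod_cast (not_le.1 hn₁).le
      have h4 : -(k₂ : ℝ) ≤ ⌊H x⌋ := by exact_mod_cast (not_le.1 hn₂).le
      have h5 := hB' j le_rfl x ⟨by linarith, by linarith⟩
      refine (h5.trans (le_of_eq (mul_one B').symm)).trans ?_
      exact (le_of_eq (by rw [pow_zero])).trans (le_weight_of_le (n := 0) (x := x)
        (by linarith) (by linarith) (Nat.zero_le _))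
  refine mem_OM_of_bounds hH fun j => ?_
  rcases Nat.eq_zero_or_pos j with rfl | hj
  -- Order zero does not follow from the iterates, since `H` and `H ∘ ψ_n` differ by the unbounded
  -- constant `n`; the mean value inequality recovers it from the bound on `H'`.
  · obtain ⟨n, C, hC⟩ := hpos 1 le_rfl
    refine ⟨n + 1, |H 0| + |C|, fun x => ?_⟩
    have hle : ∀ y ∈ Set.uIcc 0 x, ‖deriv H y‖ ≤ |C| * (1 + |x| ^ 2) ^ n := by
      intro y hy
      have hyx : |y| ≤ |x| := by
        have := Set.abs_sub_left_of_mem_uIcc hy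
        simpa using this
      have h1 := hC y
      rw [iteratedDeriv_one] at h1
      refine h1.trans ?_
      have := le_abs_self C
      gcongr
    have hmv := (convex_uIcc (0 : ℝ) x).norm_image_sub_le_of_norm_deriv_le
      (fun y _ => hH.differentiable (by simp) y) hle Set.left_mem_uIcc Set.right_mem_uIcc
    rw [sub_zero, Real.norm_eq_abs, Real.norm_eq_abs] at hmv
    rw [iteratedDeriv_zero, Real.norm_eq_abs]
    have hw := one_le_weight x
    have hwn : 1 ≤ (1 + |x| ^ 2) ^ (n + 1) := one_le_pow₀ hw
    have hx : |x| ≤ 1 + |x| ^ 2 := by nlinarith [sq_nonneg (|x| - 1), abs_nonneg x]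
    calc |H x| ≤ |H 0| + |H x - H 0| := by
          have := abs_add_le (H 0) (H x - H 0)
          rwa [add_sub_cancel] at this
      _ ≤ |H 0| * (1 + |x| ^ 2) ^ (n + 1) + |C| * (1 + |x| ^ 2) ^ n * (1 + |x| ^ 2) :=
          add_le_add (le_mul_of_one_le_right (abs_nonneg _) hwn) (hmv.trans (by gcongr))
      _ = _ := by ring
  · exact hpos j hj

end Mixing

/-! ### Transfer along quasi-conjugacies and conclusion. -/

section QuasiConjugacy

variable {𝕜 X Y : Type*} [Semiring 𝕜] [AddCommMonoid X] [Module 𝕜 X] [TopologicalSpace X]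
  [AddCommMonoid Y] [Module 𝕜 Y] [TopologicalSpace Y]

theorem IsQuasiConjugate.isHypercyclic {T : X →L[𝕜] X} {S : Y →L[𝕜] Y}
    (h : IsQuasiConjugate T S) (hS : IsHypercyclic S) : IsHypercyclic T := by
  obtain ⟨Φ, hΦ, hc⟩ := h
  obtain ⟨y, hy⟩ := hS
  have hsc : Function.Semiconj Φ S T := fun z => (DFunLike.congr_fun hc z).symm
  refine ⟨Φ y, (hΦ.dense_image Φ.continuous hy).mono ?_⟩
  rintro _ ⟨_, ⟨n, rfl⟩, rfl⟩
  exact ⟨n, ((hsc.iterate_right n).eq y).symm⟩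

theorem IsQuasiConjugate.dense_periodicPts {T : X →L[𝕜] X} {S : Y →L[𝕜] Y}
    (h : IsQuasiConjugate T S) (hS : Dense (Function.periodicPts S)) :
    Dense (Function.periodicPts T) := by
  obtain ⟨Φ, hΦ, hc⟩ := h
  have hsc : Function.Semiconj Φ S T := fun z => (DFunLike.congr_fun hc z).symm
  refine (hΦ.dense_image Φ.continuous hS).mono ?_
  rintro _ ⟨z, ⟨n, hn, hz⟩, rfl⟩
  exact ⟨n, hn, hz.map hsc⟩

end QuasiConjugacy

/-- The intertwining map is `C_H`. Only smoothness of `H⁻¹` is required, not slow growth: compactly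
supported functions stay compactly supported after composition with `H⁻¹`, so the range of `C_H`
contains all of them. -/
theorem isQuasiConjugate_of_abel {𝕜 : Type*} [RCLike 𝕜] {ψ : ℝ → ℝ} (hψ : ψ ∈ OM ℝ)
    {H : ℝ ≃ₜ ℝ} (hH : ⇑H ∈ OM ℝ) (hH' : ContDiff ℝ ∞ H.symm)
    (habel : ∀ x, H (ψ x) = H x + 1) :
    IsQuasiConjugate (compOp 𝕜 ψ hψ) (compOp 𝕜 (fun x => x + 1) add_one_mem_OM) := by
  refine ⟨compOp 𝕜 H hH, ?_, ?_⟩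
  · refine dense_hasCompactSupport.mono fun f (hf : HasCompactSupport f.toFun) => ?_
    refine ⟨OMSpace.mk (f.toFun ∘ H.symm) (mem_OM_of_hasCompactSupport
      (f.contDiff.comp hH') (hf.comp_homeomorph H.symm)), OMSpace.ext_toFun ?_⟩
    change (f.toFun ∘ H.symm) ∘ H = f.toFun
    funext x
    simp
  · ext1 f
    refine OMSpace.ext_toFun ?_
    change (f.toFun ∘ H) ∘ ψ = (f.toFun ∘ fun x => x + 1) ∘ H
    funext x
    simp [habel]

end SlowGrowth

/-- The growth conditions `hfwd` and `hbwd` on the orbit of `0` already follow from mixing: an Abel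
function of `ψ` has slowly growing derivative, hence grows slowly itself. -/
theorem corollary4p2 {𝕜 : Type*} [RCLike 𝕜] (ψ : ℝ → ℝ) (hψ : ψ ∈ SlowGrowth.OM ℝ)
    (hbij : Function.Bijective ψ)
    (hmix : SlowGrowth.IsMixing (SlowGrowth.compOp 𝕜 ψ hψ))
    (hfwd : ∀ v : 𝓢(ℝ, ℝ),
      Tendsto (fun n : ℕ => v (SlowGrowth.iter ψ hbij (n : ℤ) 0) * (n : ℝ)) atTop (𝓝 0))
    (hbwd : ∀ v : 𝓢(ℝ, ℝ),
      Tendsto (fun n : ℕ => v (SlowGrowth.iter ψ hbij (-(n : ℤ)) 0) * (n : ℝ)) atTop (𝓝 0)) :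
    SlowGrowth.IsQuasiConjugate (SlowGrowth.compOp 𝕜 ψ hψ)
      (SlowGrowth.compOp 𝕜 (fun x => x + 1) SlowGrowth.add_one_mem_OM) ∧
    SlowGrowth.IsHypercyclic (SlowGrowth.compOp 𝕜 ψ hψ) ∧
    SlowGrowth.IsChaotic (SlowGrowth.compOp 𝕜 ψ hψ) := by
  obtain ⟨e, rfl⟩ : ∃ e : Equiv.Perm ℝ, ⇑e = ψ := ⟨Equiv.ofBijective ψ hbij, rfl⟩
  have hc := SlowGrowth.contDiff_of_mem_OM hψ
  have hc' := SlowGrowth.contDiff_symm_of_deriv_ne_zero hc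
    (SlowGrowth.deriv_ne_zero_of_isMixing hmix)
  obtain ⟨H, hH, hH', habel⟩ := SlowGrowth.exists_abel hc hc' (SlowGrowth.ne_self_of_isMixing hmix)
  have hq : SlowGrowth.IsQuasiConjugate (SlowGrowth.compOp 𝕜 e hψ)
      (SlowGrowth.compOp 𝕜 (fun x => x + 1) SlowGrowth.add_one_mem_OM) :=
    SlowGrowth.isQuasiConjugate_of_abel hψ (SlowGrowth.abel_mem_OM hmix hH habel) hH' habel
  have hhyp := hq.isHypercyclic (SlowGrowth.isHypercyclic_translation 𝕜)
  exact ⟨hq, hhyp, hhyp, hq.dense_periodicPts (SlowGrowth.dense_periodicPts_translation 𝕜)⟩
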